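/- **Theorem (Duality).** Let $L\ge 1$ be an integer, $A,B,\beta_+,\beta_->0$ and $a,b\in\mathbb R$. Let $\Omega_L=(0,\infty)^{\{-L,\dots,L\}}$, and let $\mathbb N^{\Lambda_L}$, $\mathbb N=\{0,1,2,\dots\}$, $\Lambda_L=\{-L,\dots,L\}\cup\{\delta(-),\delta(+)\}$, be the set of particle configurations $n$. The *KMP process with slow/fast boundaries* is the Markov process $(\xi_t)_{t\ge 0}$ on $\Omega_L$ whose generator acts on smooth bounded functions $f:\Omega_L\to\mathbb R$ by $$\begin{aligned}(G_Lf)(\xi)=&\sum_{x=-L}^{L-1}\int_0^1\big[f(\xi^{x,p})-f(\xi)\big]\,dp+\frac{A}{L^a}\int_0^\infty\big[f(\xi^{-L\to y})-f(\xi)\big]\beta_-e^{-\beta_-y}\,dy\\&+\frac{B}{L^b}\int_0^\infty\big[f(\xi^{L\to y})-f(\xi)\big]\beta_+e^{-\beta_+y}\,dy,\end{aligned}$$ where $\xi^{x,p}$ is $\xi$ with $(\xi_x,\xi_{x+1})$ replaced by $\big(p(\xi_x+\xi_{x+1}),(1-p)(\xi_x+\xi_{x+1})\big)$, and $\xi^{x\to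 y}$ is $\xi$ with $\xi_x$ replaced by $y$. The *dual process of walkers* is the Markov process $(\eta_t)_{t\ge 0}$ on $\mathbb N^{\Lambda_L}$ whose generator acts on bounded functions $f:\mathbb N^{\Lambda_L}\to\mathbb R$ by $$\begin{aligned}(A_Lf)(n)=&\frac{A}{L^a}\big[f(n^{-})-f(n)\big]+\frac{B}{L^b}\big[f(n^{+})-f(n)\big]\\&+\sum_{x=-L}^{L-1}\frac{1}{n_x+n_{x+1}+1}\sum_{q=0}^{n_x+n_{x+1}}\big[f(n^{x,q})-f(n)\big],\end{aligned}$$ where $n^{-}$ (resp. $n^{+}$) is obtained from $n$ by moving all the particles at $-L$ to $\delta(-)$ (resp. all the particles at $L$ to $\delta(+)$), and $n^{x,q}$ is $n$ with $(n_x,n_{x+1})$ replaced by $(q,\,n_x+n_{x+1}-q)$. Here a Markov process with generator $G$ on a class $D$ of functions is a process that is Markov with respect to a semigroup $(\kappa_t)_{t\ge0}$ of probability kernels such that $(\kappa_hf-f)/h\to Gf$ uniformly as $h\downarrow0$, for every $f\in D$. Put $$F(n,\xi)=\frac{1}{\beta_+^{\,n_{\delta(+)}}\,\beta_-^{\,n_{\delta(-)}}}\prod_{x=-L}^{L}\frac{\xi_x^{n_x}}{n_x!}.$$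 Let $\zeta\in\Omega_L$ and $k\in\mathbb N^{\Lambda_L}$ (for instance, $k_{\delta(-)}=k_{\delta(+)}=0$), let $(\xi_t)$ be a KMP process with slow/fast boundaries started at $\zeta$, with expectation $\mathbf E_\zeta$, and let $(\eta_t)$ be a dual process of walkers started at $k$, with expectation $\mathbb E_k$. Then, for all $t\ge0$, $F(k,\xi_t)$ and $F(\eta_t,\zeta)$ are integrable and $$\mathbf E_\zeta\big[F(k,\xi_t)\big]=\mathbb E_k\big[F(\eta_t,\zeta)\big].$$ -/

import Mathlib

open MeasureTheory ProbabilityTheory Filter Topology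
open scoped NNReal ENNReal

noncomputable section

namespace KMP

/-! ## Markov processes given by an infinitesimal generator -/

section Markov

variable {E : Type*} [MeasurableSpace E]

/-- A Markov transition semigroup on `E`: probability kernels with the Chapman-Kolmogorov
property. -/
structure IsMarkovSemigroup (κ : ℝ≥0 → Kernel E E) : Prop where
  isMarkovKernel : ∀ t, IsMarkovKernel (κ t)
  zero : κ 0 = Kernel.id
  add : ∀ s t, κ (s + t) = κ t ∘ₖ κ s

/-- On the class `D` of functions, the infinitesimal generator of the semigroup `κ` is `G`:
for `f ∈ D`, `(κ_h f - f) / h` converges to `G f` uniformly as `h ↓ 0`. -/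
def HasGenerator (κ : ℝ≥0 → Kernel E E) (D : Set (E → ℝ)) (G : (E → ℝ) → E → ℝ) : Prop :=
  ∀ f ∈ D, TendstoUniformly
    (fun (h : ℝ≥0) (x : E) => ((∫ y, f y ∂(κ h x)) - f x) / (h : ℝ)) (G f) (𝓝[>] 0)

/-- The sigma-algebra generated by `X_r`, `0 ≤ r ≤ s`. -/
abbrev pastOf {Ω : Type*} (X : ℝ≥0 → Ω → E) (s : ℝ≥0) : MeasurableSpace Ω :=
  ⨆ r : {r : ℝ≥0 // r ≤ s}, MeasurableSpace.comap (X r) inferInstance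

/-- `X` is, under `P`, a Markov process started at `x` with transition semigroup `κ`:
`P(X_{s+t} ∈ S | X_r, r ≤ s) = κ_t(X_s, S)` almost surely. -/
structure IsMarkovProcess (κ : ℝ≥0 → Kernel E E) (x : E)
    {Ω : Type*} [MeasurableSpace Ω] (P : Measure Ω) (X : ℝ≥0 → Ω → E) : Prop where
  measurable : ∀ t, Measurable (X t)
  start : ∀ᵐ ω ∂P, X 0 ω = x
  markov : ∀ s t : ℝ≥0, ∀ S : Set E, MeasurableSet S →
    P[(X (s + t) ⁻¹' S).indicator (fun _ => (1 : ℝ)) | pastOf X s]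
      =ᵐ[P] fun ω => (κ t (X s ω)).real S

/-- `X` is, under `P`, a Markov process started at `x` whose generator, on the class `D`,
is `G`. -/
def IsMarkovProcessWithGenerator (D : Set (E → ℝ)) (G : (E → ℝ) → E → ℝ) (x : E)
    {Ω : Type*} [MeasurableSpace Ω] (P : Measure Ω) (X : ℝ≥0 → Ω → E) : Prop :=
  ∃ κ : ℝ≥0 → Kernel E E,
    IsMarkovSemigroup κ ∧ HasGenerator κ D G ∧ IsMarkovProcess κ x P X

end Markov

/-! ## Sites and bonds of the chain -/

/-- The sites `{-L, …, L}`. -/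
abbrev Site (L : ℕ) : Type := ↥(Finset.Icc (-(L : ℤ)) (L : ℤ))

/-- The bonds `{x, x + 1}` with `-L ≤ x ≤ L - 1`, labelled by their left end point `x`. -/
abbrev Bond (L : ℕ) : Type := ↥(Finset.Ico (-(L : ℤ)) (L : ℤ))

/-- The left end point `x` of the bond `{x, x + 1}`. -/
def Bond.fst {L : ℕ} (e : Bond L) : Site L :=
  ⟨e.1, by have := Finset.mem_Ico.1 e.2; exact Finset.mem_Icc.2 (by omega)⟩

/-- The right end point `x + 1` of the bond `{x, x + 1}`. -/
def Bond.snd {L : ℕ} (e : Bond L) : Site L :=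
  ⟨e.1 + 1, by have := Finset.mem_Ico.1 e.2; exact Finset.mem_Icc.2 (by omega)⟩

/-- The site `-L`. -/
def leftEnd (L : ℕ) : Site L := ⟨-(L : ℤ), Finset.mem_Icc.2 (by omega)⟩

/-- The site `L`. -/
def rightEnd (L : ℕ) : Site L := ⟨(L : ℤ), Finset.mem_Icc.2 (by omega)⟩

/-! ## The KMP process with slow/fast boundaries -/

/-- The open orthant in `ℝ^{-L, …, L}`. -/
def orthant (L : ℕ) : Set (Site L → ℝ) := {ξ | ∀ x, 0 < ξ x}

/-- Energy configurations: vectors with positive coordinates, indexed by `-L, …, L`. -/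
abbrev EnergyConfig (L : ℕ) : Type := ↥(orthant L)

/-- The configuration `ξ` with the energy at `x` replaced by `y`. -/
def setEnergy {L : ℕ} (ξ : EnergyConfig L) (x : Site L) (y : Set.Ioi (0 : ℝ)) :
    EnergyConfig L :=
  ⟨Function.update ξ.1 x y, by
    intro z
    rcases eq_or_ne z x with rfl | h
    · simpa using Set.mem_Ioi.1 y.2
    · simpa [Function.update_of_ne h] using ξ.2 z⟩

/-- The configuration `ξ` after the total energy `ξ_x + ξ_{x+1}` of the bond `{x, x + 1}` has
been split into `p (ξ_x + ξ_{x+1})` at `x` and `(1 - p) (ξ_x + ξ_{x+1})` at `x + 1`. -/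
def splitEnergy {L : ℕ} (ξ : EnergyConfig L) (e : Bond L) (p : Set.Ioo (0 : ℝ) 1) :
    EnergyConfig L :=
  setEnergy
    (setEnergy ξ e.fst
      ⟨p * (ξ.1 e.fst + ξ.1 e.snd), mul_pos p.2.1 (add_pos (ξ.2 _) (ξ.2 _))⟩)
    e.snd
    ⟨(1 - p) * (ξ.1 e.fst + ξ.1 e.snd),
      mul_pos (sub_pos.2 p.2.2) (add_pos (ξ.2 _) (ξ.2 _))⟩

/-- The generator of the KMP process with slow/fast boundaries. -/
def kmpGenerator (L : ℕ) (A B a b βp βm : ℝ) (f : EnergyConfig L → ℝ)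
    (ξ : EnergyConfig L) : ℝ :=
  (∑ e : Bond L, ∫ p : Set.Ioo (0 : ℝ) 1, (f (splitEnergy ξ e p) - f ξ) ∂(Measure.comap Subtype.val volume))
    + A / (L : ℝ) ^ a *
        ∫ y : Set.Ioi (0 : ℝ),
          (f (setEnergy ξ (leftEnd L) y) - f ξ) * (βm * Real.exp (-βm * y)) ∂(Measure.comap Subtype.val volume)
    + B / (L : ℝ) ^ b *
        ∫ y : Set.Ioi (0 : ℝ),
          (f (setEnergy ξ (rightEnd L) y) - f ξ) * (βp * Real.exp (-βp * y)) ∂(Measure.comap Subtype.val volume)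

open scoped ContDiff in
/-- The smooth bounded functions on the space of energy configurations. -/
def smoothBounded (L : ℕ) : Set (EnergyConfig L → ℝ) :=
  {f | (∃ g : (Site L → ℝ) → ℝ, ContDiffOn ℝ ∞ g (orthant L) ∧ ∀ ξ : EnergyConfig L, f ξ = g ξ)
    ∧ ∃ C : ℝ, ∀ ξ, |f ξ| ≤ C}

/-! ## The dual process of walkers -/

/-- The sites of the dual process: `{-L, …, L}` and two absorbing sites `δ(-)`, `δ(+)`. -/
inductive DualSite (L : ℕ) : Type
  | bulk (x : Site L) : DualSite L
  | deltaMinus : DualSite L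
  | deltaPlus : DualSite L
  deriving DecidableEq, Fintype

/-- Particle configurations. -/
abbrev ParticleConfig (L : ℕ) : Type := DualSite L → ℕ

/-- All the particles at `x` are moved to `y`. -/
def moveAll {L : ℕ} (n : ParticleConfig L) (x y : DualSite L) : ParticleConfig L :=
  Function.update (Function.update n y (n y + n x)) x 0

/-- The number of particles on a bond. -/
def bondParticles {L : ℕ} (n : ParticleConfig L) (e : Bond L) : ℕ :=
  n (.bulk e.fst) + n (.bulk e.snd)

/-- The configuration after the particles of the bond `{x, x + 1}` have been redistributed:
`q` at `x` and the others at `x + 1`. -/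
def splitParticles {L : ℕ} (n : ParticleConfig L) (e : Bond L) (q : ℕ) : ParticleConfig L :=
  Function.update (Function.update n (.bulk e.fst) q) (.bulk e.snd) (bondParticles n e - q)

/-- The generator of the dual process of walkers. -/
def dualGenerator (L : ℕ) (A B a b : ℝ) (f : ParticleConfig L → ℝ)
    (n : ParticleConfig L) : ℝ :=
  A / (L : ℝ) ^ a * (f (moveAll n (.bulk (leftEnd L)) .deltaMinus) - f n)
    + B / (L : ℝ) ^ b * (f (moveAll n (.bulk (rightEnd L)) .deltaPlus) - f n)
    + ∑ e : Bond L, 1 / ((bondParticles n e : ℝ) + 1) *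
        ∑ q ∈ Finset.range (bondParticles n e + 1), (f (splitParticles n e q) - f n)

/-- The bounded functions of a particle configuration. -/
def boundedFunctions (L : ℕ) : Set (ParticleConfig L → ℝ) :=
  {f | ∃ C : ℝ, ∀ n, |f n| ≤ C}

/-! ## The duality function -/

/-- `F(n, ξ) = β₊^{-n(δ(+))} β₋^{-n(δ(-))} ∏_x ξ_x^{n_x} / n_x!`. -/
def dualityFunction {L : ℕ} (βp βm : ℝ) (n : ParticleConfig L) (ξ : EnergyConfig L) : ℝ :=
  1 / (βp ^ n .deltaPlus * βm ^ n .deltaMinus)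
    * ∏ x : Site L, ξ.1 x ^ n (.bulk x) / ((n (.bulk x)).factorial : ℝ)

end KMP

end

/-!
The function `F(n, ξ) = dualityFunction βp βm n ξ` intertwines the two generators,
`(G_L F(n, ·))(ξ) = (A_L F(·, ξ))(n)`: a bond move is a beta integral on one side and the binomial
theorem on the other (`integral_dualityFunction_splitEnergy`), a reservoir move is an exponential
moment (`integral_dualityFunction_minus`, `integral_dualityFunction_plus`). The dual process
conserves the number `N` of walkers, and there are finitely many configurations of `N` walkers
(`Sector L N`). So both `n ↦ 𝔼_n[F(η_t, ζ)]` and `n ↦ 𝐄_ζ[F(n, ξ_t)]` should solve the same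
linear differential equation `y' = A_L y` in a finite-dimensional space, with the same initial
value `F(·, ζ)`, and hence agree.

On the dual side this is Kolmogorov's backward equation (`dual_solves`), because every function on
a sector extends by `0` to a bounded function, and `η_t` almost surely stays in the sector of its
starting point (`dual_ae_sum_eq`).

On the energy side `F(n, ·)` is unbounded, so it is not in the class on which the generator is
given. With `R = 1 + ∑ ξ_x`, which the bond moves conserve, the cutoff `1 / (1 + ε R ^ K)` turns
polynomials of degree at most `K` into bounded smooth functions. The generator maps the truncated
power `ψ = R ^ K / (1 + ε R ^ K)` to at most a constant times `ψ`, uniformly in `ε`, so that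
Grönwall's inequality and Fatou's lemma bound every moment of `R` at every time
(`integral_oneAddEnergy_pow_le`). The cutoff commutes with the bond moves and is changed by the
reservoir moves by `O(ε R ^ N (1 + y) ^ N)` only, where `y` is the new energy; the expectations of
the truncated `F(n, ·)` therefore solve the differential equation up to an error `O(ε)`
(`truncated_solves`), and the comparison theorem for approximate solutions of a Lipschitz
differential equation gives the identity as `ε → 0` (`semigroupAct_dualityFunction_eq`).

All derivatives in time are right derivatives, the only ones that the uniform convergence of
`(κ_h f - f) / h` as `h ↓ 0` gives directly; together with continuity they suffice for the
comparison theorems.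
-/

namespace KMP

/-! ### Transition semigroups -/

section Semigroup

variable {E : Type*} [MeasurableSpace E]

/-- The function `x ↦ κ_t f (x) = ∫ f dκ_t(x, ·)`, with time a real number, so that it can be
differentiated; negative times are sent to `0`. -/
noncomputable def semigroupAct (κ : ℝ≥0 → Kernel E E) (f : E → ℝ) (t : ℝ) (x : E) : ℝ :=
  ∫ y, f y ∂(κ t.toNNReal x)

theorem hasDerivWithinAt_Ici_of_forall_abs_le {u : ℝ → ℝ} {d t : ℝ}
    (h : ∀ ε > 0, ∃ δ > 0, ∀ s, 0 < s → s < δ → |u (t + s) - u t - s * d| ≤ ε * s) :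
    HasDerivWithinAt u d (Set.Ici t) t := by
  rw [hasDerivWithinAt_iff_isLittleO, Asymptotics.isLittleO_iff]
  intro ε hε
  obtain ⟨δ, hδ, H⟩ := h ε hε
  have hball : Set.Iio (t + δ) ∈ 𝓝 t := Iio_mem_nhds (by linarith)
  filter_upwards [mem_nhdsWithin_of_mem_nhds hball, self_mem_nhdsWithin] with z hz hz'
  rcases eq_or_lt_of_le (Set.mem_Ici.1 hz') with rfl | hlt
  · simp
  · have := H (z - t) (by linarith) (by have := Set.mem_Iio.1 hz; linarith)
    rw [add_sub_cancel] at this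
    simpa [Real.norm_eq_abs, abs_of_pos (sub_pos.2 hlt)] using this

theorem IsMarkovSemigroup.integrable {κ : ℝ≥0 → Kernel E E} (hκ : IsMarkovSemigroup κ)
    {f : E → ℝ} (hf : Measurable f) {C : ℝ} (hC : ∀ x, |f x| ≤ C) (t : ℝ≥0) (x : E) :
    Integrable f (κ t x) := by
  have := hκ.isMarkovKernel t
  exact Integrable.of_bound hf.aestronglyMeasurable C (Eventually.of_forall hC)

theorem IsMarkovSemigroup.abs_integral_le {κ : ℝ≥0 → Kernel E E} (hκ : IsMarkovSemigroup κ)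
    {f : E → ℝ} {C : ℝ} (hC : ∀ x, |f x| ≤ C) (t : ℝ≥0) (x : E) :
    |∫ y, f y ∂(κ t x)| ≤ C := by
  have := hκ.isMarkovKernel t
  simpa using norm_integral_le_of_norm_le_const (μ := κ t x) (f := f) (Eventually.of_forall hC)

theorem IsMarkovSemigroup.measurable_semigroupAct {κ : ℝ≥0 → Kernel E E}
    (hκ : IsMarkovSemigroup κ) {f : E → ℝ} (hf : Measurable f) (t : ℝ) :
    Measurable (semigroupAct κ f t) := by
  have := hκ.isMarkovKernel t.toNNReal
  exact (StronglyMeasurable.integral_kernel hf.stronglyMeasurable).measurable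

theorem IsMarkovSemigroup.semigroupAct_zero {κ : ℝ≥0 → Kernel E E}
    (hκ : IsMarkovSemigroup κ) {f : E → ℝ} (hf : Measurable f) (x : E) :
    semigroupAct κ f 0 x = f x := by
  simp only [semigroupAct, Real.toNNReal_zero, hκ.zero, Kernel.id_apply]
  exact integral_dirac' f x hf.stronglyMeasurable

theorem IsMarkovSemigroup.semigroupAct_add {κ : ℝ≥0 → Kernel E E} (hκ : IsMarkovSemigroup κ)
    {f : E → ℝ} (hf : Measurable f) {C : ℝ} (hC : ∀ x, |f x| ≤ C) {s t : ℝ} (hs : 0 ≤ s)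
    (ht : 0 ≤ t) (x : E) :
    semigroupAct κ f (s + t) x = semigroupAct κ (semigroupAct κ f t) s x := by
  have h1 := hκ.add s.toNNReal t.toNNReal
  have h2 := hκ.integrable hf hC (s.toNNReal + t.toNNReal) x
  simp only [semigroupAct, Real.toNNReal_add hs ht]
  rw [h1] at h2 ⊢
  exact Kernel.integral_comp h2

theorem HasGenerator.eventually_abs_le {κ : ℝ≥0 → Kernel E E} {D : Set (E → ℝ)}
    {G : (E → ℝ) → E → ℝ} (hG : HasGenerator κ D G) {f : E → ℝ} (hfD : f ∈ D) {ε : ℝ}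
    (hε : 0 < ε) :
    ∃ δ > 0, ∀ s, 0 < s → s < δ → ∀ x, |semigroupAct κ f s x - f x - s * G f x| ≤ ε * s := by
  have h := Metric.tendstoUniformly_iff.1 (hG f hfD) ε hε
  rw [eventually_nhdsWithin_iff, Metric.eventually_nhds_iff] at h
  obtain ⟨δ, hδ, H⟩ := h
  refine ⟨δ, hδ, fun s hs hsδ x => ?_⟩
  have hs' : ((s.toNNReal : ℝ≥0) : ℝ) = s := Real.coe_toNNReal s hs.le
  have := H (y := s.toNNReal)
    (by rw [NNReal.dist_eq, hs']; simpa [abs_of_pos hs] using hsδ)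
    (by simpa using hs) x
  rw [dist_comm, Real.dist_eq, hs'] at this
  have e : semigroupAct κ f s x - f x - s * G f x
      = ((∫ y, f y ∂(κ s.toNNReal x) - f x) / s - G f x) * s := by
    simp only [semigroupAct]
    field_simp
  rw [e, abs_mul, abs_of_pos hs]
  exact mul_le_mul_of_nonneg_right this.le hs.le

theorem HasGenerator.measurable {κ : ℝ≥0 → Kernel E E} (hκ : IsMarkovSemigroup κ)
    {D : Set (E → ℝ)} {G : (E → ℝ) → E → ℝ} (hG : HasGenerator κ D G) {f : E → ℝ}
    (hfD : f ∈ D) (hf : Measurable f) : Measurable (G f) := by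
  refine measurable_of_tendsto_metrizable' (𝓝[>] (0 : ℝ≥0))
    (f := fun (h : ℝ≥0) (x : E) => ((∫ y, f y ∂(κ h x)) - f x) / (h : ℝ)) (fun h => ?_)
    (tendsto_pi_nhds.2 fun x => (hG f hfD).tendsto_at x)
  have := hκ.isMarkovKernel h
  exact (((StronglyMeasurable.integral_kernel hf.stronglyMeasurable).measurable).sub hf).div_const _

theorem HasGenerator.exists_bound {κ : ℝ≥0 → Kernel E E} (hκ : IsMarkovSemigroup κ)
    {D : Set (E → ℝ)} {G : (E → ℝ) → E → ℝ} (hG : HasGenerator κ D G) {f : E → ℝ}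
    (hfD : f ∈ D) {C : ℝ} (hC : ∀ x, |f x| ≤ C) : ∃ C', ∀ x, |G f x| ≤ C' := by
  obtain ⟨δ, hδ, H⟩ := hG.eventually_abs_le hfD one_pos
  refine ⟨(2 * C + δ / 2) / (δ / 2), fun x => ?_⟩
  have h1 := abs_le.1 (H (δ / 2) (by linarith) (by linarith) x)
  have h2 := abs_le.1 (hκ.abs_integral_le hC (δ / 2).toNNReal x)
  have h3 := abs_le.1 (hC x)
  simp only [semigroupAct] at h1
  rw [le_div_iff₀ (by positivity), ← abs_of_pos (half_pos hδ), ← abs_mul,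
    abs_of_pos (half_pos hδ), abs_le]
  constructor <;> nlinarith

/-- Kolmogorov's forward equation. -/
theorem HasGenerator.hasDerivWithinAt_forward {κ : ℝ≥0 → Kernel E E}
    (hκ : IsMarkovSemigroup κ) {D : Set (E → ℝ)} {G : (E → ℝ) → E → ℝ}
    (hG : HasGenerator κ D G) {f : E → ℝ} (hfD : f ∈ D) (hf : Measurable f) {C : ℝ}
    (hC : ∀ x, |f x| ≤ C) (x : E) {t : ℝ} (ht : 0 ≤ t) :
    HasDerivWithinAt (fun s => semigroupAct κ f s x) (semigroupAct κ (G f) t x)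
      (Set.Ici t) t := by
  refine hasDerivWithinAt_Ici_of_forall_abs_le fun ε hε => ?_
  obtain ⟨δ, hδ, H⟩ := hG.eventually_abs_le hfD hε
  refine ⟨δ, hδ, fun s hs hsδ => ?_⟩
  obtain ⟨C', hC'⟩ := hG.exists_bound hκ hfD hC
  have i1 : Integrable (semigroupAct κ f s) (κ t.toNNReal x) :=
    hκ.integrable (hκ.measurable_semigroupAct hf s) (fun y => hκ.abs_integral_le hC _ y) _ x
  have i2 := hκ.integrable hf hC t.toNNReal x
  have i3 := hκ.integrable (hG.measurable hκ hfD hf) hC' t.toNNReal x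
  have e : semigroupAct κ f (t + s) x - semigroupAct κ f t x - s * semigroupAct κ (G f) t x
      = ∫ y, (semigroupAct κ f s y - f y - s * G f y) ∂(κ t.toNNReal x) := by
    have i12 : Integrable (fun y => semigroupAct κ f s y - f y) (κ t.toNNReal x) := i1.sub i2
    rw [hκ.semigroupAct_add hf hC ht hs.le, integral_sub i12 (i3.const_mul s),
      integral_sub i1 i2, integral_const_mul]
    rfl
  rw [e]
  exact hκ.abs_integral_le (H s hs hsδ) _ x

/-- Kolmogorov's backward equation, for `f` such that `κ_t f` stays in the class `D`. -/
theorem HasGenerator.hasDerivWithinAt_backward {κ : ℝ≥0 → Kernel E E}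
    (hκ : IsMarkovSemigroup κ) {D : Set (E → ℝ)} {G : (E → ℝ) → E → ℝ}
    (hG : HasGenerator κ D G) {f : E → ℝ} (hf : Measurable f) {C : ℝ}
    (hC : ∀ x, |f x| ≤ C) (x : E) {t : ℝ} (ht : 0 ≤ t) (hfD : semigroupAct κ f t ∈ D) :
    HasDerivWithinAt (fun s => semigroupAct κ f s x) (G (semigroupAct κ f t) x)
      (Set.Ici t) t := by
  refine hasDerivWithinAt_Ici_of_forall_abs_le fun ε hε => ?_
  obtain ⟨δ, hδ, H⟩ := hG.eventually_abs_le hfD hε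
  refine ⟨δ, hδ, fun s hs hsδ => ?_⟩
  rw [add_comm t s, hκ.semigroupAct_add hf hC hs.le ht]
  exact H s hs hsδ x

/-- Since `κ_s f - f = O(s)` in the supremum norm, `t ↦ κ_t f (x)` is Lipschitz at every scale
below some `δ`, hence continuous. -/
theorem HasGenerator.continuousOn {κ : ℝ≥0 → Kernel E E}
    (hκ : IsMarkovSemigroup κ) {D : Set (E → ℝ)} {G : (E → ℝ) → E → ℝ}
    (hG : HasGenerator κ D G) {f : E → ℝ} (hfD : f ∈ D) (hf : Measurable f) {C : ℝ}
    (hC : ∀ x, |f x| ≤ C) (x : E) :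
    ContinuousOn (fun s => semigroupAct κ f s x) (Set.Ici 0) := by
  obtain ⟨δ, hδ, H⟩ := hG.eventually_abs_le hfD one_pos
  obtain ⟨C', hC'⟩ := hG.exists_bound hκ hfD hC
  have key : ∀ t s : ℝ, 0 ≤ t → 0 < s → s < δ →
      |semigroupAct κ f (t + s) x - semigroupAct κ f t x| ≤ (C' + 1) * s := by
    intro t s ht hs hsδ
    have i1 : Integrable (semigroupAct κ f s) (κ t.toNNReal x) :=
      hκ.integrable (hκ.measurable_semigroupAct hf s) (fun y => hκ.abs_integral_le hC _ y) _ x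
    have e : semigroupAct κ f (t + s) x - semigroupAct κ f t x
        = ∫ y, (semigroupAct κ f s y - f y) ∂(κ t.toNNReal x) := by
      rw [hκ.semigroupAct_add hf hC ht hs.le, integral_sub i1 (hκ.integrable hf hC _ x)]
      rfl
    rw [e]
    refine hκ.abs_integral_le (fun y => ?_) _ x
    have h1 := abs_le.1 (H s hs hsδ y)
    have h2 := abs_le.1 (hC' y)
    rw [abs_le]
    constructor <;> nlinarith
  have hC0 : 0 ≤ C' := (abs_nonneg _).trans (hC' x)
  rw [Metric.continuousOn_iff]
  intro t ht ε hε
  refine ⟨min δ (ε / (C' + 1)), by positivity, fun s hs hst => ?_⟩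
  rw [Real.dist_eq] at hst ⊢
  have h1 : |s - t| < δ := hst.trans_le (min_le_left _ _)
  have h2 : (C' + 1) * |s - t| < ε := by
    have := hst.trans_le (min_le_right _ _)
    rwa [lt_div_iff₀ (by positivity), mul_comm] at this
  rcases lt_trichotomy s t with h | rfl | h
  · have := key s (t - s) hs (by linarith) (by rwa [abs_sub_comm, abs_of_pos (by linarith)] at h1)
    rw [abs_sub_comm s t, abs_of_pos (by linarith : 0 < t - s)] at h2
    rw [add_sub_cancel, abs_sub_comm] at this
    exact this.trans_lt h2
  · simpa using hε
  · have := key t (s - t) ht (by linarith) (by rwa [abs_of_pos (by linarith)] at h1)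
    rw [abs_of_pos (by linarith : 0 < s - t)] at h2
    rw [add_sub_cancel] at this
    exact this.trans_lt h2

/-- The law of `X_t` is `κ_t(x, ·)`: the Markov property at time `0`, integrated. -/
theorem IsMarkovProcess.map_eq {κ : ℝ≥0 → Kernel E E} (hκ : IsMarkovSemigroup κ) {x : E}
    {Ω : Type*} [MeasurableSpace Ω] {P : Measure Ω} [IsProbabilityMeasure P]
    {X : ℝ≥0 → Ω → E} (hX : IsMarkovProcess κ x P X) (t : ℝ≥0) : P.map (X t) = κ t x := by
  have := hκ.isMarkovKernel t
  have := Measure.isProbabilityMeasure_map (μ := P) (hX.measurable t).aemeasurable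
  refine Measure.ext fun S hS => ?_
  rw [← measureReal_eq_measureReal_iff]
  have hle : pastOf X 0 ≤ (inferInstance : MeasurableSpace Ω) :=
    iSup_le fun r => (hX.measurable r).comap_le
  have h1 := integral_condExp (μ := P) hle
    (f := (X (0 + t) ⁻¹' S).indicator (fun _ => (1 : ℝ)))
  have h2 : ∫ ω, (P[(X (0 + t) ⁻¹' S).indicator (fun _ => (1 : ℝ)) | pastOf X 0]) ω ∂P
      = ∫ _, (κ t x).real S ∂P := by
    refine integral_congr_ae ?_
    filter_upwards [hX.markov 0 t S hS, hX.start] with ω h h'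
    rw [h, h']
  rw [h2, zero_add] at h1
  have e : (fun _ => (1 : ℝ)) = (1 : Ω → ℝ) := rfl
  rw [e, integral_indicator_one (hX.measurable t hS)] at h1
  rw [map_measureReal_apply (hX.measurable t) hS]
  simpa using h1.symm

end Semigroup

end KMP
namespace KMP

/-! ### Beta and exponential integrals -/

theorem integral_Ioo_pow_mul_one_sub_pow (m n : ℕ) :
    ∫ p : Set.Ioo (0 : ℝ) 1, (p : ℝ) ^ m * (1 - (p : ℝ)) ^ n ∂(Measure.comap Subtype.val volume)
      = (m.factorial * n.factorial : ℝ) / (m + n + 1).factorial := by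
  rw [integral_subtype_comap measurableSet_Ioo (fun p : ℝ => p ^ m * (1 - p) ^ n),
    ← integral_Ioc_eq_integral_Ioo, ← intervalIntegral.integral_of_le zero_le_one]
  have h := Complex.Gamma_mul_Gamma_eq_betaIntegral (s := (m : ℂ) + 1) (t := (n : ℂ) + 1)
    (by simp; positivity) (by simp; positivity)
  have e : Complex.betaIntegral ((m : ℂ) + 1) ((n : ℂ) + 1)
      = ((∫ p in (0 : ℝ)..1, p ^ m * (1 - p) ^ n : ℝ) : ℂ) := by
    rw [Complex.betaIntegral, ← intervalIntegral.integral_ofReal]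
    simp
  have e2 : (m : ℂ) + 1 + (n + 1) = ((m + n + 1 : ℕ) : ℂ) + 1 := by push_cast; ring
  rw [e, e2, Complex.Gamma_nat_eq_factorial, Complex.Gamma_nat_eq_factorial,
    Complex.Gamma_nat_eq_factorial] at h
  have h' : (m.factorial * n.factorial : ℝ)
      = (m + n + 1).factorial * ∫ p in (0 : ℝ)..1, p ^ m * (1 - p) ^ n := by exact_mod_cast h
  rw [h', mul_div_cancel_left₀ _ (by positivity)]

theorem integral_Ioi_pow_mul_exp {β : ℝ} (hβ : 0 < β) (m : ℕ) :
    ∫ y : Set.Ioi (0 : ℝ), (y : ℝ) ^ m * (β * Real.exp (-β * y))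
        ∂(Measure.comap Subtype.val volume) = m.factorial / β ^ m := by
  rw [integral_subtype_comap measurableSet_Ioi (fun y : ℝ => y ^ m * (β * Real.exp (-β * y)))]
  have h := Real.integral_rpow_mul_exp_neg_mul_Ioi (a := m + 1) (r := β) (by positivity) hβ
  rw [Real.Gamma_nat_eq_factorial] at h
  have e : ∀ y : ℝ, y ^ m * (β * Real.exp (-β * y))
      = β * (y ^ ((m : ℝ) + 1 - 1) * Real.exp (-(β * y))) := by
    intro y
    rw [add_sub_cancel_right, Real.rpow_natCast]
    ring_nf
  simp_rw [e]
  rw [integral_const_mul, h]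
  have e3 : (1 / β) ^ ((m : ℝ) + 1) = (1 / β) ^ (m + 1) := by
    rw [← Real.rpow_natCast]; push_cast; rfl
  rw [e3, one_div, inv_pow, pow_succ]
  field_simp

theorem integrable_Ioi_pow_mul_exp {β : ℝ} (hβ : 0 < β) (m : ℕ) :
    Integrable (fun y : Set.Ioi (0 : ℝ) => (y : ℝ) ^ m * (β * Real.exp (-β * y)))
      (Measure.comap Subtype.val volume) := by
  -- The integral of a function that is not integrable would be `0`.
  by_contra h
  have := integral_Ioi_pow_mul_exp hβ m
  rw [integral_undef h] at this
  have : 0 < (m.factorial : ℝ) / β ^ m := by positivity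
  linarith

theorem integrable_Ioo_pow_mul_one_sub_pow (m n : ℕ) :
    Integrable (fun p : Set.Ioo (0 : ℝ) 1 => (p : ℝ) ^ m * (1 - (p : ℝ)) ^ n)
      (Measure.comap Subtype.val volume) := by
  -- The integral of a function that is not integrable would be `0`.
  by_contra h
  have := integral_Ioo_pow_mul_one_sub_pow m n
  rw [integral_undef h] at this
  have : 0 < (m.factorial * n.factorial : ℝ) / (m + n + 1).factorial := by positivity
  linarith

theorem integral_Ioo_const (c : ℝ) :
    ∫ _ : Set.Ioo (0 : ℝ) 1, c ∂(Measure.comap Subtype.val volume) = c := by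
  have := integral_Ioo_pow_mul_one_sub_pow 0 0
  simp only [pow_zero, mul_one, Nat.factorial_zero, Nat.cast_one, add_zero, zero_add,
    Nat.factorial_one, div_one] at this
  rw [← mul_one c, integral_const_mul, this]

theorem integrable_Ioo_const (c : ℝ) :
    Integrable (fun _ : Set.Ioo (0 : ℝ) 1 => c) (Measure.comap Subtype.val volume) := by
  simpa using (integrable_Ioo_pow_mul_one_sub_pow 0 0).const_mul c

theorem integral_Ioi_exp {β : ℝ} (hβ : 0 < β) :
    ∫ y : Set.Ioi (0 : ℝ), β * Real.exp (-β * y) ∂(Measure.comap Subtype.val volume) = 1 := by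
  simpa using integral_Ioi_pow_mul_exp hβ 0

theorem integrable_Ioi_one_add_pow_mul_exp {β : ℝ} (hβ : 0 < β) (K : ℕ) :
    Integrable (fun y : Set.Ioi (0 : ℝ) => (1 + (y : ℝ)) ^ K * (β * Real.exp (-β * y)))
      (Measure.comap Subtype.val volume) := by
  have e : (fun y : Set.Ioi (0 : ℝ) => (1 + (y : ℝ)) ^ K * (β * Real.exp (-β * y)))
      = fun y : Set.Ioi (0 : ℝ) => ∑ j ∈ Finset.range (K + 1),
          (K.choose j : ℝ) * ((y : ℝ) ^ (K - j) * (β * Real.exp (-β * y))) := by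
    funext y
    rw [add_pow, Finset.sum_mul]
    refine Finset.sum_congr rfl fun j _ => ?_
    ring
  rw [e]
  exact integrable_finsetSum _ fun j _ => (integrable_Ioi_pow_mul_exp hβ _).const_mul _

/-- The moment `E[(1 + Y) ^ K]` of an exponential variable `Y` of parameter `β`. -/
noncomputable def expMoment (β : ℝ) (K : ℕ) : ℝ :=
  ∫ y : Set.Ioi (0 : ℝ), (1 + (y : ℝ)) ^ K * (β * Real.exp (-β * y))
    ∂(Measure.comap Subtype.val volume)

theorem expMoment_nonneg {β : ℝ} (hβ : 0 < β) (K : ℕ) : 0 ≤ expMoment β K := by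
  refine integral_nonneg fun y => ?_
  have : (0 : ℝ) < y := y.2
  simp only [Pi.zero_apply]
  positivity

theorem integrable_mul_exp_of_le {β : ℝ} (hβ : 0 < β) {h : Set.Ioi (0 : ℝ) → ℝ}
    (hm : Measurable h) {C : ℝ} {K : ℕ} (hh : ∀ y, |h y| ≤ C * (1 + (y : ℝ)) ^ K) :
    Integrable (fun y : Set.Ioi (0 : ℝ) => h y * (β * Real.exp (-β * y)))
      (Measure.comap Subtype.val volume) := by
  refine ((integrable_Ioi_one_add_pow_mul_exp hβ K).const_mul C).mono'
    (by fun_prop) (Eventually.of_forall fun y => ?_)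
  have h0 : 0 < β * Real.exp (-β * y) := by positivity
  rw [Real.norm_eq_abs, abs_mul, abs_of_pos h0, ← mul_assoc C]
  exact mul_le_mul_of_nonneg_right (hh y) h0.le

theorem integral_mul_exp_le {β : ℝ} (hβ : 0 < β) {h : Set.Ioi (0 : ℝ) → ℝ} {C : ℝ} {K : ℕ}
    (hm : Measurable h) (hh : ∀ y, |h y| ≤ C * (1 + (y : ℝ)) ^ K) :
    |∫ y : Set.Ioi (0 : ℝ), h y * (β * Real.exp (-β * y)) ∂(Measure.comap Subtype.val volume)|
      ≤ C * expMoment β K := by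
  rw [expMoment, ← integral_const_mul]
  refine (abs_integral_le_integral_abs).trans ?_
  refine integral_mono (integrable_mul_exp_of_le hβ hm hh).abs
    ((integrable_Ioi_one_add_pow_mul_exp hβ K).const_mul C) fun y => ?_
  have h0 : 0 < β * Real.exp (-β * y) := by positivity
  simp only [abs_mul, abs_of_pos h0]
  rw [← mul_assoc C]
  exact mul_le_mul_of_nonneg_right (hh y) h0.le

/-! ### Duality of the generators -/

variable {L : ℕ}

theorem Bond.fst_ne_snd (e : Bond L) : e.fst ≠ e.snd := by
  intro h
  have := congrArg Subtype.val h
  simp [Bond.fst, Bond.snd] at this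

theorem dualityFunction_nonneg {βp βm : ℝ} (hβp : 0 < βp) (hβm : 0 < βm) (n : ParticleConfig L)
    (ξ : EnergyConfig L) : 0 ≤ dualityFunction βp βm n ξ := by
  have : ∀ x, 0 ≤ ξ.1 x ^ n (.bulk x) / ((n (.bulk x)).factorial : ℝ) := fun x => by
    have := (ξ.2 x).le
    positivity
  unfold dualityFunction
  exact mul_nonneg (by positivity) (Finset.prod_nonneg fun x _ => this x)

theorem integral_dualityFunction_setEnergy {β : ℝ} (hβ : 0 < β) (βp βm : ℝ)
    (n : ParticleConfig L) (ξ : EnergyConfig L) (x : Site L) :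
    ∫ y : Set.Ioi (0 : ℝ), dualityFunction βp βm n (setEnergy ξ x y) * (β * Real.exp (-β * y))
        ∂(Measure.comap Subtype.val volume)
      = 1 / (βp ^ n .deltaPlus * βm ^ n .deltaMinus * β ^ n (.bulk x))
        * ∏ z ∈ Finset.univ.erase x, ξ.1 z ^ n (.bulk z) / ((n (.bulk z)).factorial : ℝ) := by
  have e : ∀ y : Set.Ioi (0 : ℝ),
      dualityFunction βp βm n (setEnergy ξ x y) * (β * Real.exp (-β * y))
      = (1 / (βp ^ n .deltaPlus * βm ^ n .deltaMinus)
        * (∏ z ∈ Finset.univ.erase x, ξ.1 z ^ n (.bulk z) / ((n (.bulk z)).factorial : ℝ))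
        / (n (.bulk x)).factorial) * ((y : ℝ) ^ n (.bulk x) * (β * Real.exp (-β * y))) := by
    intro y
    have h1 : ∏ z ∈ Finset.univ.erase x,
          (setEnergy ξ x y).1 z ^ n (.bulk z) / ((n (.bulk z)).factorial : ℝ)
        = ∏ z ∈ Finset.univ.erase x, ξ.1 z ^ n (.bulk z) / ((n (.bulk z)).factorial : ℝ) := by
      refine Finset.prod_congr rfl fun z hz => ?_
      simp [setEnergy, Function.update_of_ne (Finset.ne_of_mem_erase hz)]
    rw [dualityFunction, ← Finset.mul_prod_erase _ _ (Finset.mem_univ x), h1]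
    simp only [setEnergy, Function.update_self]
    ring
  simp_rw [e]
  rw [integral_const_mul, integral_Ioi_pow_mul_exp hβ]
  have : ((n (.bulk x)).factorial : ℝ) ≠ 0 := by positivity
  field_simp

/-- The reservoir moves of the two generators are dual to each other. -/
theorem integral_dualityFunction_minus {βp βm : ℝ} (hβm : 0 < βm) (n : ParticleConfig L)
    (ξ : EnergyConfig L) (x : Site L) :
    ∫ y : Set.Ioi (0 : ℝ), dualityFunction βp βm n (setEnergy ξ x y) * (βm * Real.exp (-βm * y))
        ∂(Measure.comap Subtype.val volume)
      = dualityFunction βp βm (moveAll n (.bulk x) .deltaMinus) ξ := by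
  rw [integral_dualityFunction_setEnergy hβm, dualityFunction,
    ← Finset.mul_prod_erase _ _ (Finset.mem_univ x)]
  have h1 : ∏ z ∈ Finset.univ.erase x, ξ.1 z ^ moveAll n (.bulk x) .deltaMinus (.bulk z)
        / ((moveAll n (.bulk x) .deltaMinus (.bulk z)).factorial : ℝ)
      = ∏ z ∈ Finset.univ.erase x, ξ.1 z ^ n (.bulk z) / ((n (.bulk z)).factorial : ℝ) := by
    refine Finset.prod_congr rfl fun z hz => ?_
    have : z ≠ x := Finset.ne_of_mem_erase hz
    simp [moveAll, this]
  rw [h1]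
  simp [moveAll, pow_add, mul_assoc]

theorem integral_dualityFunction_plus {βp βm : ℝ} (hβp : 0 < βp) (n : ParticleConfig L)
    (ξ : EnergyConfig L) (x : Site L) :
    ∫ y : Set.Ioi (0 : ℝ), dualityFunction βp βm n (setEnergy ξ x y) * (βp * Real.exp (-βp * y))
        ∂(Measure.comap Subtype.val volume)
      = dualityFunction βp βm (moveAll n (.bulk x) .deltaPlus) ξ := by
  rw [integral_dualityFunction_setEnergy hβp, dualityFunction,
    ← Finset.mul_prod_erase _ _ (Finset.mem_univ x)]
  have h1 : ∏ z ∈ Finset.univ.erase x, ξ.1 z ^ moveAll n (.bulk x) .deltaPlus (.bulk z)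
        / ((moveAll n (.bulk x) .deltaPlus (.bulk z)).factorial : ℝ)
      = ∏ z ∈ Finset.univ.erase x, ξ.1 z ^ n (.bulk z) / ((n (.bulk z)).factorial : ℝ) := by
    refine Finset.prod_congr rfl fun z hz => ?_
    have : z ≠ x := Finset.ne_of_mem_erase hz
    simp [moveAll, this]
  rw [h1]
  simp [moveAll, pow_add, mul_assoc, mul_left_comm, mul_comm]

/-- The part of `dualityFunction βp βm n ξ` that does not involve the sites of the bond `e`. -/
noncomputable def dualityFunctionOff (βp βm : ℝ) (n : ParticleConfig L) (ξ : EnergyConfig L)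
    (e : Bond L) : ℝ :=
  1 / (βp ^ n .deltaPlus * βm ^ n .deltaMinus)
    * ∏ z ∈ (Finset.univ.erase e.fst).erase e.snd,
        ξ.1 z ^ n (.bulk z) / ((n (.bulk z)).factorial : ℝ)

theorem dualityFunction_eq_mul_off (βp βm : ℝ) (n : ParticleConfig L) (ξ : EnergyConfig L)
    (e : Bond L) :
    dualityFunction βp βm n ξ = dualityFunctionOff βp βm n ξ e
      * (ξ.1 e.fst ^ n (.bulk e.fst) / ((n (.bulk e.fst)).factorial : ℝ))
      * (ξ.1 e.snd ^ n (.bulk e.snd) / ((n (.bulk e.snd)).factorial : ℝ)) := by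
  rw [dualityFunction, dualityFunctionOff, ← Finset.mul_prod_erase _ _ (Finset.mem_univ e.fst),
    ← Finset.mul_prod_erase (Finset.univ.erase e.fst) _
      (Finset.mem_erase.2 ⟨e.fst_ne_snd.symm, Finset.mem_univ _⟩)]
  ring

theorem dualityFunction_splitEnergy (βp βm : ℝ) (n : ParticleConfig L) (ξ : EnergyConfig L)
    (e : Bond L) (p : Set.Ioo (0 : ℝ) 1) :
    dualityFunction βp βm n (splitEnergy ξ e p) = dualityFunctionOff βp βm n ξ e
      * ((ξ.1 e.fst + ξ.1 e.snd) ^ bondParticles n e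
        / ((n (.bulk e.fst)).factorial * (n (.bulk e.snd)).factorial))
      * ((p : ℝ) ^ n (.bulk e.fst) * (1 - (p : ℝ)) ^ n (.bulk e.snd)) := by
  have h1 : dualityFunctionOff βp βm n (splitEnergy ξ e p) e
      = dualityFunctionOff βp βm n ξ e := by
    unfold dualityFunctionOff
    congr 1
    refine Finset.prod_congr rfl fun z hz => ?_
    have h1 : z ≠ e.snd := Finset.ne_of_mem_erase hz
    have h2 : z ≠ e.fst := Finset.ne_of_mem_erase (Finset.mem_of_mem_erase hz)
    simp [splitEnergy, setEnergy, h1, h2]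
  rw [dualityFunction_eq_mul_off _ _ _ _ e, h1]
  simp only [splitEnergy, setEnergy, Function.update_apply, e.fst_ne_snd, if_true, if_false,
    mul_pow, bondParticles, pow_add]
  field_simp

theorem dualityFunction_splitParticles (βp βm : ℝ) (n : ParticleConfig L) (ξ : EnergyConfig L)
    (e : Bond L) (q : ℕ) :
    dualityFunction βp βm (splitParticles n e q) ξ = dualityFunctionOff βp βm n ξ e
      * (ξ.1 e.fst ^ q / (q.factorial : ℝ))
      * (ξ.1 e.snd ^ (bondParticles n e - q) / ((bondParticles n e - q).factorial : ℝ)) := by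
  have h1 : dualityFunctionOff βp βm (splitParticles n e q) ξ e
      = dualityFunctionOff βp βm n ξ e := by
    unfold dualityFunctionOff
    refine congrArg₂ (· * ·) (by simp [splitParticles])
      (Finset.prod_congr rfl fun z hz => ?_)
    have h1 : z ≠ e.snd := Finset.ne_of_mem_erase hz
    have h2 : z ≠ e.fst := Finset.ne_of_mem_erase (Finset.mem_of_mem_erase hz)
    simp [splitParticles, h1, h2]
  rw [dualityFunction_eq_mul_off _ _ _ _ e, h1]
  simp [splitParticles, e.fst_ne_snd]

/-- The bond moves of the two generators are dual to each other: the beta integral on one side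
and the binomial theorem on the other both give `(ξ_x + ξ_{x+1}) ^ m / (m + 1)!`, where `m` is
the number of particles on the bond. -/
theorem integral_dualityFunction_splitEnergy (βp βm : ℝ) (n : ParticleConfig L)
    (ξ : EnergyConfig L) (e : Bond L) :
    ∫ p : Set.Ioo (0 : ℝ) 1, dualityFunction βp βm n (splitEnergy ξ e p)
        ∂(Measure.comap Subtype.val volume)
      = 1 / ((bondParticles n e : ℝ) + 1) * ∑ q ∈ Finset.range (bondParticles n e + 1),
          dualityFunction βp βm (splitParticles n e q) ξ := by
  simp_rw [dualityFunction_splitEnergy, dualityFunction_splitParticles]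
  rw [integral_const_mul, integral_Ioo_pow_mul_one_sub_pow, add_pow]
  change _ * ((_ : ℝ) / (bondParticles n e + 1).factorial) = _
  rw [Nat.factorial_succ]
  have h1 : ((n (.bulk e.fst)).factorial : ℝ) ≠ 0 := by positivity
  have h2 : ((n (.bulk e.snd)).factorial : ℝ) ≠ 0 := by positivity
  have h3 : ((bondParticles n e).factorial : ℝ) ≠ 0 := by positivity
  have h4 : (bondParticles n e : ℝ) + 1 ≠ 0 := by positivity
  have e2 : ∀ q ∈ Finset.range (bondParticles n e + 1),
      ξ.1 e.fst ^ q * ξ.1 e.snd ^ (bondParticles n e - q) * ((bondParticles n e).choose q : ℝ)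
      = (bondParticles n e).factorial * (ξ.1 e.fst ^ q / (q.factorial : ℝ)
      * (ξ.1 e.snd ^ (bondParticles n e - q) / ((bondParticles n e - q).factorial : ℝ))) := by
    intro q hq
    rw [Nat.cast_choose ℝ (Nat.lt_succ_iff.1 (Finset.mem_range.1 hq))]
    ring
  rw [Finset.sum_congr rfl e2, ← Finset.mul_sum]
  simp_rw [mul_assoc]
  rw [← Finset.mul_sum]
  push_cast
  field_simp

end KMP
namespace KMP

variable {L : ℕ}

/-! ### Truncated polynomials of the energies -/

/-- `1 + ∑ ξ_x`, a quantity that the bond moves conserve. -/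
noncomputable def oneAddEnergy (ξ : EnergyConfig L) : ℝ := 1 + ∑ x, ξ.1 x

theorem one_le_oneAddEnergy (ξ : EnergyConfig L) : 1 ≤ oneAddEnergy ξ := by
  have : 0 ≤ ∑ x, ξ.1 x := Finset.sum_nonneg fun x _ => (ξ.2 x).le
  unfold oneAddEnergy
  linarith

theorem oneAddEnergy_pos (ξ : EnergyConfig L) : 0 < oneAddEnergy ξ :=
  zero_lt_one.trans_le (one_le_oneAddEnergy ξ)

theorem energy_le_oneAddEnergy (ξ : EnergyConfig L) (x : Site L) : ξ.1 x ≤ oneAddEnergy ξ := by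
  have := Finset.single_le_sum (fun x _ => (ξ.2 x).le) (Finset.mem_univ x)
  unfold oneAddEnergy
  linarith

theorem oneAddEnergy_setEnergy (ξ : EnergyConfig L) (x : Site L) (y : Set.Ioi (0 : ℝ)) :
    oneAddEnergy (setEnergy ξ x y) = oneAddEnergy ξ - ξ.1 x + y := by
  simp only [oneAddEnergy, setEnergy]
  rw [Finset.sum_update_of_mem (Finset.mem_univ x),
    ← Finset.sum_sdiff (Finset.subset_univ {x}) (f := ξ.1), Finset.sum_singleton]
  ring

theorem oneAddEnergy_setEnergy_le (ξ : EnergyConfig L) (x : Site L) (y : Set.Ioi (0 : ℝ)) :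
    oneAddEnergy (setEnergy ξ x y) ≤ oneAddEnergy ξ * (1 + y) := by
  rw [oneAddEnergy_setEnergy]
  have h1 := ξ.2 x
  have h2 : (0 : ℝ) < y := y.2
  nlinarith [one_le_oneAddEnergy ξ]

theorem oneAddEnergy_splitEnergy (ξ : EnergyConfig L) (e : Bond L) (p : Set.Ioo (0 : ℝ) 1) :
    oneAddEnergy (splitEnergy ξ e p) = oneAddEnergy ξ := by
  rw [splitEnergy, oneAddEnergy_setEnergy, oneAddEnergy_setEnergy]
  simp only [setEnergy, Function.update_of_ne e.fst_ne_snd.symm]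
  ring

theorem measurable_oneAddEnergy : Measurable (oneAddEnergy : EnergyConfig L → ℝ) := by
  unfold oneAddEnergy
  fun_prop

/-- The factor `1 / (1 + ε R ^ K)`, with `R = oneAddEnergy`, which makes polynomials of degree at
most `K` bounded and tends to `1` as `ε → 0`. -/
noncomputable def cutoff (ε : ℝ) (K : ℕ) (ξ : EnergyConfig L) : ℝ :=
  1 / (1 + ε * oneAddEnergy ξ ^ K)

section Cutoff

variable {ε : ℝ} (hε : 0 < ε) (K : ℕ)
include hε

theorem cutoff_nonneg (ξ : EnergyConfig L) : 0 ≤ cutoff ε K ξ := by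
  have := oneAddEnergy_pos ξ
  unfold cutoff
  positivity

theorem cutoff_le_one (ξ : EnergyConfig L) : cutoff ε K ξ ≤ 1 := by
  have := oneAddEnergy_pos ξ
  unfold cutoff
  rw [div_le_one (by positivity)]
  have : 0 ≤ ε * oneAddEnergy ξ ^ K := by positivity
  linarith

theorem pow_mul_cutoff_le (ξ : EnergyConfig L) : oneAddEnergy ξ ^ K * cutoff ε K ξ ≤ 1 / ε := by
  have := oneAddEnergy_pos ξ
  unfold cutoff
  rw [mul_one_div, div_le_div_iff₀ (by positivity) hε]
  nlinarith

theorem abs_cutoff_sub_le (ξ ξ' : EnergyConfig L) :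
    |cutoff ε K ξ - cutoff ε K ξ'| ≤ ε * |oneAddEnergy ξ ^ K - oneAddEnergy ξ' ^ K| := by
  have h1 := oneAddEnergy_pos ξ
  have h2 := oneAddEnergy_pos ξ'
  have e : cutoff ε K ξ - cutoff ε K ξ'
      = -(ε * (oneAddEnergy ξ ^ K - oneAddEnergy ξ' ^ K) * (cutoff ε K ξ * cutoff ε K ξ')) := by
    unfold cutoff
    field_simp
    ring
  have h3 : cutoff ε K ξ * cutoff ε K ξ' ≤ 1 :=
    mul_le_one₀ (cutoff_le_one hε K ξ) (cutoff_nonneg hε K ξ') (cutoff_le_one hε K ξ')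
  rw [e, abs_neg, abs_mul, abs_mul, abs_of_pos hε,
    abs_of_nonneg (mul_nonneg (cutoff_nonneg hε K ξ) (cutoff_nonneg hε K ξ'))]
  exact mul_le_of_le_one_right (by positivity) h3

theorem abs_one_sub_cutoff_le (ξ : EnergyConfig L) :
    |1 - cutoff ε K ξ| ≤ ε * oneAddEnergy ξ ^ K := by
  have h1 := oneAddEnergy_pos ξ
  rw [abs_of_nonneg (by linarith [cutoff_le_one hε K ξ])]
  have e : 1 - cutoff ε K ξ = ε * oneAddEnergy ξ ^ K * cutoff ε K ξ := by
    unfold cutoff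
    field_simp
    ring
  rw [e]
  exact mul_le_of_le_one_right (by positivity) (cutoff_le_one hε K ξ)

theorem mul_cutoff_mem_smoothBounded {g : (Site L → ℝ) → ℝ} (hg : ContDiff ℝ (⊤ : ℕ∞) g) {C : ℝ}
    (hC : ∀ ξ : EnergyConfig L, |g ξ.1| ≤ C * oneAddEnergy ξ ^ K) :
    (fun ξ : EnergyConfig L => g ξ.1 * cutoff ε K ξ) ∈ smoothBounded L
      ∧ ∀ ξ : EnergyConfig L, |g ξ.1 * cutoff ε K ξ| ≤ C * (1 / ε) := by
  have hb : ∀ ξ : EnergyConfig L, |g ξ.1 * cutoff ε K ξ| ≤ C * (1 / ε) := by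
    intro ξ
    have h1 := oneAddEnergy_pos ξ
    have hC0 : 0 ≤ C := nonneg_of_mul_nonneg_left ((abs_nonneg _).trans (hC ξ)) (by positivity)
    rw [abs_mul, abs_of_nonneg (cutoff_nonneg hε K ξ)]
    calc |g ξ.1| * cutoff ε K ξ ≤ C * oneAddEnergy ξ ^ K * cutoff ε K ξ :=
          mul_le_mul_of_nonneg_right (hC ξ) (cutoff_nonneg hε K ξ)
      _ = C * (oneAddEnergy ξ ^ K * cutoff ε K ξ) := by ring
      _ ≤ C * (1 / ε) := mul_le_mul_of_nonneg_left (pow_mul_cutoff_le hε K ξ) hC0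
  refine ⟨⟨⟨fun z => g z * (1 / (1 + ε * (1 + ∑ x, z x) ^ K)), ?_, fun ξ => rfl⟩, _, hb⟩, hb⟩
  refine hg.contDiffOn.mul (contDiffOn_const.div (by fun_prop) fun z hz => ?_)
  have : 0 ≤ ∑ x, z x := Finset.sum_nonneg fun x _ => (hz x).le
  positivity

end Cutoff

theorem measurable_cutoff (ε : ℝ) (K : ℕ) :
    Measurable (cutoff ε K : EnergyConfig L → ℝ) := by
  have := measurable_oneAddEnergy (L := L)
  unfold cutoff
  fun_prop

theorem measurable_setEnergy (ξ : EnergyConfig L) (x : Site L) : Measurable (setEnergy ξ x) := by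
  refine Measurable.subtype_mk (measurable_pi_iff.2 fun z => ?_)
  rcases eq_or_ne z x with rfl | h
  · simpa using measurable_subtype_coe
  · simp [Function.update_of_ne h]

/-! ### Moment bounds for the energies -/

section Moments

variable {A B a b βp βm : ℝ}

/-- A bound for the growth rate of the moment of order `K` of the total energy. -/
noncomputable def growthRate (L : ℕ) (A B a b βp βm : ℝ) (K : ℕ) : ℝ :=
  A / (L : ℝ) ^ a * expMoment βm K + B / (L : ℝ) ^ b * expMoment βp K

theorem growthRate_nonneg (hA : 0 < A) (hB : 0 < B) (hβp : 0 < βp) (hβm : 0 < βm) (K : ℕ) :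
    0 ≤ growthRate L A B a b βp βm K := by
  have h1 := expMoment_nonneg hβp K
  have h2 := expMoment_nonneg hβm K
  unfold growthRate
  positivity

/-- The truncated power `R ^ K / (1 + ε R ^ K)` is an increasing function of `R` that grows at
most by the factor `c ^ K` when `R` is multiplied by `c ≥ 1`. -/
theorem pow_mul_cutoff_setEnergy_le {ε : ℝ} (hε : 0 < ε) (K : ℕ) (ξ : EnergyConfig L)
    (x : Site L) (y : Set.Ioi (0 : ℝ)) :
    oneAddEnergy (setEnergy ξ x y) ^ K * cutoff ε K (setEnergy ξ x y)
      ≤ oneAddEnergy ξ ^ K * cutoff ε K ξ * (1 + (y : ℝ)) ^ K := by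
  have h1 := oneAddEnergy_pos ξ
  have h2 := oneAddEnergy_pos (setEnergy ξ x y)
  have hy : (0 : ℝ) < y := y.2
  have h3 : oneAddEnergy (setEnergy ξ x y) ^ K ≤ oneAddEnergy ξ ^ K * (1 + (y : ℝ)) ^ K := by
    rw [← mul_pow]
    exact pow_le_pow_left₀ h2.le (oneAddEnergy_setEnergy_le ξ x y) K
  have h4 : 1 ≤ (1 + (y : ℝ)) ^ K := one_le_pow₀ (by linarith)
  unfold cutoff
  set u := oneAddEnergy (setEnergy ξ x y) ^ K
  set v := oneAddEnergy ξ ^ K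
  set c := (1 + (y : ℝ)) ^ K
  have hu : 0 < u := by positivity
  have hv : 0 < v := by positivity
  rw [mul_one_div, mul_one_div, div_mul_eq_mul_div, div_le_div_iff₀ (by positivity) (by positivity)]
  have h5 : ε * u * v ≤ ε * u * (v * c) :=
    mul_le_mul_of_nonneg_left (le_mul_of_one_le_right hv.le h4) (by positivity)
  nlinarith

theorem kmpGenerator_pow_mul_cutoff_le (hA : 0 < A) (hB : 0 < B) (hβp : 0 < βp) (hβm : 0 < βm)
    {ε : ℝ} (hε : 0 < ε) (K : ℕ) (ξ : EnergyConfig L) :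
    kmpGenerator L A B a b βp βm (fun ξ => oneAddEnergy ξ ^ K * cutoff ε K ξ) ξ
      ≤ growthRate L A B a b βp βm K * (oneAddEnergy ξ ^ K * cutoff ε K ξ) := by
  have hbd : ∀ {β : ℝ}, 0 < β → ∀ x : Site L,
      ∫ y : Set.Ioi (0 : ℝ), (oneAddEnergy (setEnergy ξ x y) ^ K * cutoff ε K (setEnergy ξ x y)
        - oneAddEnergy ξ ^ K * cutoff ε K ξ) * (β * Real.exp (-β * y))
        ∂(Measure.comap Subtype.val volume)
      ≤ oneAddEnergy ξ ^ K * cutoff ε K ξ * expMoment β K := by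
    intro β hβ x
    refine (le_abs_self _).trans (integral_mul_exp_le hβ ?_ fun y => ?_)
    · have h1 := (measurable_oneAddEnergy (L := L)).comp (measurable_setEnergy ξ x)
      have h2 := (measurable_cutoff (L := L) ε K).comp (measurable_setEnergy ξ x)
      exact ((h1.pow_const K).mul h2).sub_const _
    · have h1 := pow_mul_cutoff_setEnergy_le hε K ξ x y
      have hy : (0 : ℝ) < y := y.2
      have h4 : 1 ≤ (1 + (y : ℝ)) ^ K := one_le_pow₀ (by linarith)
      have h5 : ∀ ξ : EnergyConfig L, 0 ≤ oneAddEnergy ξ ^ K * cutoff ε K ξ := fun ξ =>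
        mul_nonneg (pow_nonneg (oneAddEnergy_pos ξ).le K) (cutoff_nonneg hε K ξ)
      have h6 := le_mul_of_one_le_right (h5 ξ) h4
      rw [abs_le]
      constructor <;> linarith [h5 ξ, h5 (setEnergy ξ x y)]
  have hbulk : ∀ (e : Bond L) (p : Set.Ioo (0 : ℝ) 1),
      oneAddEnergy (splitEnergy ξ e p) ^ K * cutoff ε K (splitEnergy ξ e p)
        - oneAddEnergy ξ ^ K * cutoff ε K ξ = 0 := by
    intro e p
    simp only [cutoff, oneAddEnergy_splitEnergy, sub_self]
  unfold kmpGenerator growthRate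
  simp only [hbulk, integral_zero, Finset.sum_const_zero, zero_add]
  have h1 := mul_le_mul_of_nonneg_left (hbd hβm (leftEnd L))
    (show 0 ≤ A / (L : ℝ) ^ a by positivity)
  have h2 := mul_le_mul_of_nonneg_left (hbd hβp (rightEnd L))
    (show 0 ≤ B / (L : ℝ) ^ b by positivity)
  calc _ ≤ _ := add_le_add h1 h2
    _ = _ := by ring

variable {κ : ℝ≥0 → Kernel (EnergyConfig L) (EnergyConfig L)}

theorem semigroupAct_pow_mul_cutoff_le (hA : 0 < A) (hB : 0 < B) (hβp : 0 < βp) (hβm : 0 < βm)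
    (hκ : IsMarkovSemigroup κ)
    (hG : HasGenerator κ (smoothBounded L) (kmpGenerator L A B a b βp βm))
    {ε : ℝ} (hε : 0 < ε) (K : ℕ) (ζ : EnergyConfig L) {t : ℝ} (ht : 0 ≤ t) :
    semigroupAct κ (fun ξ => oneAddEnergy ξ ^ K * cutoff ε K ξ) t ζ
      ≤ oneAddEnergy ζ ^ K * Real.exp (growthRate L A B a b βp βm K * t) := by
  set ψ : EnergyConfig L → ℝ := fun ξ => oneAddEnergy ξ ^ K * cutoff ε K ξ
  obtain ⟨hψD, hψb⟩ := mul_cutoff_mem_smoothBounded (L := L) hε K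
    (g := fun z => (1 + ∑ x, z x) ^ K) (C := 1) (by fun_prop) (fun ξ => by
      rw [one_mul]
      exact (abs_of_nonneg (pow_nonneg (oneAddEnergy_pos ξ).le K)).le)
  have hψm : Measurable ψ := (measurable_oneAddEnergy.pow_const K).mul (measurable_cutoff ε K)
  obtain ⟨C', hC'⟩ := hG.exists_bound hκ hψD hψb
  have h := le_gronwallBound_of_liminf_deriv_right_le (f := fun s => semigroupAct κ ψ s ζ)
    (f' := fun s => semigroupAct κ (kmpGenerator L A B a b βp βm ψ) s ζ)
    (δ := ψ ζ) (K := growthRate L A B a b βp βm K) (ε := 0) (a := 0) (b := t)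
    ((hG.continuousOn hκ hψD hψm hψb ζ).mono Set.Icc_subset_Ici_self)
    (fun s hs r hr =>
      (hG.hasDerivWithinAt_forward hκ hψD hψm hψb ζ hs.1).liminf_right_slope_le hr)
    (hκ.semigroupAct_zero hψm ζ).le
    (fun s hs => by
      simp only [semigroupAct, add_zero]
      rw [← integral_const_mul]
      exact integral_mono (hκ.integrable (hG.measurable hκ hψD hψm) hC' _ ζ)
        ((hκ.integrable hψm hψb _ ζ).const_mul _)
        (fun ξ => kmpGenerator_pow_mul_cutoff_le hA hB hβp hβm hε K ξ))
    t ⟨ht, le_rfl⟩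
  rw [gronwallBound_ε0, sub_zero] at h
  refine h.trans (mul_le_mul_of_nonneg_right ?_ (Real.exp_pos _).le)
  exact mul_le_of_le_one_right (pow_nonneg (oneAddEnergy_pos ζ).le K) (cutoff_le_one hε K ζ)

theorem tendsto_cutoff (K : ℕ) (ξ : EnergyConfig L) :
    Tendsto (fun ε => cutoff ε K ξ) (𝓝[>] 0) (𝓝 1) := by
  have h : ContinuousAt (fun ε : ℝ => 1 / (1 + ε * oneAddEnergy ξ ^ K)) 0 :=
    ContinuousAt.div (by fun_prop) (by fun_prop) (by simp)
  have h2 := h.tendsto.mono_left (nhdsWithin_le_nhds (s := Set.Ioi 0))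
  simpa [cutoff] using h2

/-- All moments of the total energy are finite at all times: Fatou's lemma removes the cutoff
from the uniform bound on the truncated moments. -/
theorem lintegral_oneAddEnergy_pow_le (hA : 0 < A) (hB : 0 < B) (hβp : 0 < βp) (hβm : 0 < βm)
    (hκ : IsMarkovSemigroup κ)
    (hG : HasGenerator κ (smoothBounded L) (kmpGenerator L A B a b βp βm))
    (K : ℕ) (ζ : EnergyConfig L) (t : ℝ≥0) :
    ∫⁻ ξ, ENNReal.ofReal (oneAddEnergy ξ ^ K) ∂(κ t ζ)
      ≤ ENNReal.ofReal (oneAddEnergy ζ ^ K * Real.exp (growthRate L A B a b βp βm K * t)) := by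
  have := hκ.isMarkovKernel t
  have hm : ∀ ε : ℝ, Measurable fun ξ : EnergyConfig L => oneAddEnergy ξ ^ K * cutoff ε K ξ :=
    fun ε => (measurable_oneAddEnergy.pow_const K).mul (measurable_cutoff ε K)
  have hnn : ∀ ε > 0, ∀ ξ : EnergyConfig L, 0 ≤ oneAddEnergy ξ ^ K * cutoff ε K ξ :=
    fun ε hε ξ => mul_nonneg (pow_nonneg (oneAddEnergy_pos ξ).le K) (cutoff_nonneg hε K ξ)
  let e : ℕ → ℝ := fun M => 1 / ((M : ℝ) + 1)
  have he : ∀ M, 0 < e M := fun M => by positivity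
  have he0 : Tendsto e atTop (𝓝[>] 0) :=
    tendsto_nhdsWithin_iff.2 ⟨tendsto_one_div_add_atTop_nhds_zero_nat, Eventually.of_forall he⟩
  have hlim : ∀ ξ : EnergyConfig L, Tendsto
      (fun M => ENNReal.ofReal (oneAddEnergy ξ ^ K * cutoff (e M) K ξ)) atTop
      (𝓝 (ENNReal.ofReal (oneAddEnergy ξ ^ K))) := by
    intro ξ
    have := ((tendsto_cutoff K ξ).comp he0).const_mul (oneAddEnergy ξ ^ K)
    rw [mul_one] at this
    exact ENNReal.tendsto_ofReal this
  calc ∫⁻ ξ, ENNReal.ofReal (oneAddEnergy ξ ^ K) ∂(κ t ζ)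
      = ∫⁻ ξ, liminf (fun M => ENNReal.ofReal (oneAddEnergy ξ ^ K * cutoff (e M) K ξ)) atTop
          ∂(κ t ζ) := lintegral_congr fun ξ => (hlim ξ).liminf_eq.symm
    _ ≤ liminf (fun M => ∫⁻ ξ, ENNReal.ofReal (oneAddEnergy ξ ^ K * cutoff (e M) K ξ) ∂(κ t ζ))
          atTop := lintegral_liminf_le fun M => (hm _).ennreal_ofReal
    _ ≤ _ := by
      refine liminf_le_of_le (by isBoundedDefault) fun c hc => ?_
      obtain ⟨M, hM⟩ := hc.exists
      refine hM.trans ?_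
      have hb : ∀ ξ : EnergyConfig L, |oneAddEnergy ξ ^ K * cutoff (e M) K ξ| ≤ 1 / e M :=
        fun ξ => by
          rw [abs_of_nonneg (hnn _ (he M) ξ)]
          exact pow_mul_cutoff_le (he M) K ξ
      rw [← ofReal_integral_eq_lintegral_ofReal (hκ.integrable (hm _) hb t ζ)
        (Eventually.of_forall (hnn _ (he M)))]
      refine ENNReal.ofReal_le_ofReal ?_
      have := semigroupAct_pow_mul_cutoff_le hA hB hβp hβm hκ hG (he M) K ζ t.2
      simpa [semigroupAct] using this

theorem integrable_oneAddEnergy_pow (hA : 0 < A) (hB : 0 < B) (hβp : 0 < βp) (hβm : 0 < βm)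
    (hκ : IsMarkovSemigroup κ)
    (hG : HasGenerator κ (smoothBounded L) (kmpGenerator L A B a b βp βm))
    (K : ℕ) (ζ : EnergyConfig L) (t : ℝ≥0) :
    Integrable (fun ξ => oneAddEnergy ξ ^ K) (κ t ζ) := by
  refine ⟨(measurable_oneAddEnergy.pow_const K).aestronglyMeasurable, ?_⟩
  rw [hasFiniteIntegral_iff_ofReal
    (Eventually.of_forall fun ξ => pow_nonneg (oneAddEnergy_pos ξ).le K)]
  exact (lintegral_oneAddEnergy_pow_le hA hB hβp hβm hκ hG K ζ t).trans_lt ENNReal.ofReal_lt_top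

theorem integral_oneAddEnergy_pow_le (hA : 0 < A) (hB : 0 < B) (hβp : 0 < βp) (hβm : 0 < βm)
    (hκ : IsMarkovSemigroup κ)
    (hG : HasGenerator κ (smoothBounded L) (kmpGenerator L A B a b βp βm))
    (K : ℕ) (ζ : EnergyConfig L) (t : ℝ≥0) :
    ∫ ξ, oneAddEnergy ξ ^ K ∂(κ t ζ)
      ≤ oneAddEnergy ζ ^ K * Real.exp (growthRate L A B a b βp βm K * t) := by
  have h := lintegral_oneAddEnergy_pow_le hA hB hβp hβm hκ hG K ζ t
  rw [← ofReal_integral_eq_lintegral_ofReal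
    (integrable_oneAddEnergy_pow hA hB hβp hβm hκ hG K ζ t)
    (Eventually.of_forall fun ξ => pow_nonneg (oneAddEnergy_pos ξ).le K)] at h
  exact (ENNReal.ofReal_le_ofReal_iff
    (mul_nonneg (pow_nonneg (oneAddEnergy_pos ζ).le K) (Real.exp_pos _).le)).1 h

end Moments

end KMP
namespace KMP

variable {L : ℕ}

/-! ### Conservation of the number of walkers -/

theorem sum_update_add {ι : Type*} [Fintype ι] [DecidableEq ι] (n : ι → ℕ) (i : ι) (v : ℕ) :
    ∑ j, Function.update n i v j + n i = ∑ j, n j + v := by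
  rw [Finset.sum_update_of_mem (Finset.mem_univ i),
    ← Finset.sum_sdiff (Finset.subset_univ {i}) (f := n), Finset.sum_singleton]
  ring

theorem sum_moveAll (n : ParticleConfig L) {x y : DualSite L} (h : x ≠ y) :
    ∑ i, moveAll n x y i = ∑ i, n i := by
  have h1 := sum_update_add (Function.update n y (n y + n x)) x 0
  have h2 := sum_update_add n y (n y + n x)
  rw [Function.update_of_ne h] at h1
  unfold moveAll
  omega

theorem sum_splitParticles (n : ParticleConfig L) (e : Bond L) {q : ℕ}
    (hq : q ≤ bondParticles n e) : ∑ i, splitParticles n e q i = ∑ i, n i := by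
  have h1 := sum_update_add (Function.update n (.bulk e.fst) q) (.bulk e.snd)
    (bondParticles n e - q)
  have h2 := sum_update_add n (.bulk e.fst) q
  have h : DualSite.bulk e.snd ≠ DualSite.bulk e.fst := fun h =>
    e.fst_ne_snd (DualSite.bulk.inj h).symm
  rw [Function.update_of_ne h] at h1
  unfold splitParticles
  unfold bondParticles at *
  omega

theorem sum_bulk_le (n : ParticleConfig L) : ∑ x : Site L, n (.bulk x) ≤ ∑ i, n i := by
  rw [← Finset.sum_image (f := n) (s := Finset.univ) (g := DualSite.bulk)
    (fun x _ y _ h => DualSite.bulk.inj h)]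
  exact Finset.sum_le_sum_of_subset (Finset.subset_univ _)

/-- The dual generator only compares configurations with the same number of walkers. -/
theorem dualGenerator_congr (A B a b : ℝ) {f g : ParticleConfig L → ℝ} {n : ParticleConfig L}
    (h : ∀ m, ∑ i, m i = ∑ i, n i → f m = g m) :
    dualGenerator L A B a b f n = dualGenerator L A B a b g n := by
  unfold dualGenerator
  rw [h n rfl, h _ (sum_moveAll n (by simp)), h _ (sum_moveAll n (by simp))]
  congr 1
  refine Finset.sum_congr rfl fun e _ => ?_
  congr 1
  refine Finset.sum_congr rfl fun q hq => ?_
  rw [h _ (sum_splitParticles n e (Nat.lt_succ_iff.1 (Finset.mem_range.1 hq)))]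

theorem dualGenerator_const (A B a b c : ℝ) (n : ParticleConfig L) :
    dualGenerator L A B a b (fun _ => c) n = 0 := by
  simp [dualGenerator]

theorem dualGenerator_sub (A B a b : ℝ) (f g : ParticleConfig L → ℝ) (n : ParticleConfig L) :
    dualGenerator L A B a b f n - dualGenerator L A B a b g n
      = dualGenerator L A B a b (fun m => f m - g m) n := by
  have e : ∀ e : Bond L, 1 / ((bondParticles n e : ℝ) + 1) *
        ∑ q ∈ Finset.range (bondParticles n e + 1),
          (f (splitParticles n e q) - g (splitParticles n e q) - (f n - g n))
      = 1 / ((bondParticles n e : ℝ) + 1) *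
        ∑ q ∈ Finset.range (bondParticles n e + 1), (f (splitParticles n e q) - f n)
      - 1 / ((bondParticles n e : ℝ) + 1) *
        ∑ q ∈ Finset.range (bondParticles n e + 1), (g (splitParticles n e q) - g n) := by
    intro e
    rw [← mul_sub, ← Finset.sum_sub_distrib]
    congr 1
    refine Finset.sum_congr rfl fun q _ => ?_
    ring
  unfold dualGenerator
  simp_rw [e]
  rw [Finset.sum_sub_distrib]
  ring

theorem abs_dualGenerator_le {A B : ℝ} (hA : 0 < A) (hB : 0 < B) (a b : ℝ)
    {f : ParticleConfig L → ℝ} {C : ℝ} (hC : ∀ n, |f n| ≤ C) (n : ParticleConfig L) :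
    |dualGenerator L A B a b f n|
      ≤ (2 * (A / (L : ℝ) ^ a + B / (L : ℝ) ^ b + Fintype.card (Bond L))) * C := by
  have h2 : ∀ m, |f m - f n| ≤ 2 * C := fun m => by
    have h3 := abs_le.1 (hC m)
    have h4 := abs_le.1 (hC n)
    rw [abs_le]
    constructor <;> linarith
  have hb : ∀ e : Bond L, |1 / ((bondParticles n e : ℝ) + 1) *
        ∑ q ∈ Finset.range (bondParticles n e + 1), (f (splitParticles n e q) - f n)|
        ≤ 2 * C := by
    intro e
    have h3 : |∑ q ∈ Finset.range (bondParticles n e + 1), (f (splitParticles n e q) - f n)|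
        ≤ ((bondParticles n e : ℝ) + 1) * (2 * C) := by
      refine (Finset.abs_sum_le_sum_abs _ _).trans
        ((Finset.sum_le_card_nsmul _ _ (2 * C) fun q _ => h2 _).trans ?_)
      simp
    rw [abs_mul, abs_of_pos (by positivity), one_div, inv_mul_le_iff₀ (by positivity)]
    exact h3
  have hsum : |∑ e : Bond L, 1 / ((bondParticles n e : ℝ) + 1) *
        ∑ q ∈ Finset.range (bondParticles n e + 1), (f (splitParticles n e q) - f n)|
        ≤ Fintype.card (Bond L) * (2 * C) := by
    refine (Finset.abs_sum_le_sum_abs _ _).trans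
      ((Finset.sum_le_card_nsmul _ _ (2 * C) fun e _ => hb e).trans ?_)
    simp
  have hA' : 0 ≤ A / (L : ℝ) ^ a := by positivity
  have hB' : 0 ≤ B / (L : ℝ) ^ b := by positivity
  unfold dualGenerator
  refine (abs_add_three _ _ _).trans ?_
  rw [abs_mul, abs_mul (B / _), abs_of_nonneg hA', abs_of_nonneg hB']
  have h3 := mul_le_mul_of_nonneg_left (h2 (moveAll n (.bulk (leftEnd L)) .deltaMinus)) hA'
  have h4 := mul_le_mul_of_nonneg_left (h2 (moveAll n (.bulk (rightEnd L)) .deltaPlus)) hB'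
  linarith

theorem dualGenerator_integral {X : Type*} [MeasurableSpace X] {μ : Measure X} (A B a b : ℝ)
    {h : ParticleConfig L → X → ℝ} {n : ParticleConfig L}
    (hi : ∀ m, ∑ i, m i = ∑ i, n i → Integrable (h m) μ) :
    Integrable (fun x => dualGenerator L A B a b (fun m => h m x) n) μ ∧
    ∫ x, dualGenerator L A B a b (fun m => h m x) n ∂μ
      = dualGenerator L A B a b (fun m => ∫ x, h m x ∂μ) n := by
  have h0 := hi n rfl
  have hm := hi _ (sum_moveAll n (x := .bulk (leftEnd L)) (y := .deltaMinus) (by simp))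
  have hp := hi _ (sum_moveAll n (x := .bulk (rightEnd L)) (y := .deltaPlus) (by simp))
  have hq : ∀ e : Bond L, ∀ q ∈ Finset.range (bondParticles n e + 1),
      Integrable (h (splitParticles n e q)) μ := fun e q hq =>
    hi _ (sum_splitParticles n e (Nat.lt_succ_iff.1 (Finset.mem_range.1 hq)))
  have i1 : Integrable (fun x => A / (L : ℝ) ^ a *
      (h (moveAll n (.bulk (leftEnd L)) .deltaMinus) x - h n x)) μ := (hm.sub h0).const_mul _
  have i2 : Integrable (fun x => B / (L : ℝ) ^ b *
      (h (moveAll n (.bulk (rightEnd L)) .deltaPlus) x - h n x)) μ := (hp.sub h0).const_mul _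
  have i4 : ∀ e : Bond L, Integrable (fun x => 1 / ((bondParticles n e : ℝ) + 1) *
        ∑ q ∈ Finset.range (bondParticles n e + 1), (h (splitParticles n e q) x - h n x)) μ :=
    fun e => (integrable_finsetSum _ fun q hq' => (hq e q hq').sub h0).const_mul _
  have i3 : Integrable (fun x => ∑ e : Bond L, 1 / ((bondParticles n e : ℝ) + 1) *
        ∑ q ∈ Finset.range (bondParticles n e + 1), (h (splitParticles n e q) x - h n x)) μ :=
    integrable_finsetSum _ fun e _ => i4 e
  have i12 : Integrable (fun x => A / (L : ℝ) ^ a *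
      (h (moveAll n (.bulk (leftEnd L)) .deltaMinus) x - h n x) + B / (L : ℝ) ^ b *
      (h (moveAll n (.bulk (rightEnd L)) .deltaPlus) x - h n x)) μ := i1.add i2
  unfold dualGenerator
  refine ⟨i12.add i3, ?_⟩
  rw [integral_add i12 i3, integral_add i1 i2, integral_const_mul, integral_const_mul,
    integral_sub hm h0, integral_sub hp h0, integral_finsetSum _ fun e _ => i4 e]
  congr 1
  refine Finset.sum_congr rfl fun e _ => ?_
  have i5 : ∀ q ∈ Finset.range (bondParticles n e + 1),
      Integrable (fun x => h (splitParticles n e q) x - h n x) μ :=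
    fun q hq' => (hq e q hq').sub h0
  rw [integral_const_mul, integral_finsetSum _ i5]
  congr 1
  refine Finset.sum_congr rfl fun q hq' => ?_
  exact integral_sub (hq e q hq') h0

/-! ### The dual generator on configurations with a fixed number of walkers -/

/-- The configurations of `N` walkers, those at the absorbing sites included. -/
abbrev Sector (L N : ℕ) : Type := {n : ParticleConfig L // ∑ i, n i = N}

instance (L N : ℕ) : Finite (Sector L N) := by
  have h : (Set.Iic (fun _ : DualSite L => N)).Finite := Set.finite_Iic _
  refine Set.Finite.to_subtype (h.subset fun n hn i => ?_)
  rw [← (show ∑ i, n i = N from hn)]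
  exact Finset.single_le_sum (fun _ _ => Nat.zero_le _) (Finset.mem_univ i)

noncomputable instance (L N : ℕ) : Fintype (Sector L N) := Fintype.ofFinite _

variable {N : ℕ}

/-- The extension by `0` of a function on the configurations of `N` walkers. -/
noncomputable def extendSector (y : Sector L N → ℝ) (n : ParticleConfig L) : ℝ :=
  if h : ∑ i, n i = N then y ⟨n, h⟩ else 0

theorem extendSector_of_sum_eq (y : Sector L N → ℝ) {n : ParticleConfig L} (h : ∑ i, n i = N) :
    extendSector y n = y ⟨n, h⟩ := dif_pos h

theorem abs_extendSector_le (y : Sector L N → ℝ) (n : ParticleConfig L) :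
    |extendSector y n| ≤ ‖y‖ := by
  unfold extendSector
  split_ifs with h
  · exact norm_le_pi_norm y ⟨n, h⟩
  · simp

/-- The dual generator restricted to the functions of the configurations of `N` walkers. Since
the number of walkers is conserved, the extension by `0` outside the sector is immaterial. -/
noncomputable def sectorGenerator (L N : ℕ) (A B a b : ℝ) (y : Sector L N → ℝ) (n : Sector L N) : ℝ :=
  dualGenerator L A B a b (extendSector y) n.1

theorem sectorGenerator_eq (A B a b : ℝ) {f : ParticleConfig L → ℝ} {y : Sector L N → ℝ}
    (h : ∀ n : Sector L N, y n = f n.1) (n : Sector L N) :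
    sectorGenerator L N A B a b y n = dualGenerator L A B a b f n.1 := by
  refine dualGenerator_congr A B a b fun m hm => ?_
  rw [extendSector_of_sum_eq y (hm.trans n.2), h]

theorem exists_lipschitzWith_sectorGenerator {A B : ℝ} (hA : 0 < A) (hB : 0 < B) (L N : ℕ)
    (a b : ℝ) : ∃ K : ℝ≥0, 0 < K ∧ LipschitzWith K (sectorGenerator L N A B a b) := by
  have h0 : 0 ≤ 2 * (A / (L : ℝ) ^ a + B / (L : ℝ) ^ b + Fintype.card (Bond L)) := by positivity
  -- The summand `1` makes the constant positive, as the closed form of Grönwall's bound requires.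
  refine ⟨(2 * (A / (L : ℝ) ^ a + B / (L : ℝ) ^ b + Fintype.card (Bond L))).toNNReal + 1, by positivity,
    LipschitzWith.of_dist_le_mul fun y z => ?_⟩
  rw [dist_pi_le_iff (by positivity)]
  intro n
  rw [Real.dist_eq, sectorGenerator, sectorGenerator, dualGenerator_sub]
  have hb : ∀ m, |extendSector y m - extendSector z m| ≤ dist y z := by
    intro m
    have e : extendSector y m - extendSector z m = extendSector (y - z) m := by
      unfold extendSector
      split_ifs <;> simp
    rw [e, dist_eq_norm]
    exact abs_extendSector_le _ _
  refine (abs_dualGenerator_le hA hB a b hb n.1).trans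
    (mul_le_mul_of_nonneg_right ?_ dist_nonneg)
  rw [NNReal.coe_add, Real.coe_toNNReal _ h0, NNReal.coe_one]
  exact le_add_of_nonneg_right zero_le_one

/-! ### The dual process -/

section Dual

variable {A B a b : ℝ} {κ : ℝ≥0 → Kernel (ParticleConfig L) (ParticleConfig L)}

theorem dual_ae_sum_eq (hκ : IsMarkovSemigroup κ)
    (hG : HasGenerator κ (boundedFunctions L) (dualGenerator L A B a b))
    (k : ParticleConfig L) (t : ℝ≥0) : ∀ᵐ n ∂(κ t k), ∑ i, n i = ∑ i, k i := by
  have := hκ.isMarkovKernel t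
  set S : Set (ParticleConfig L) := {n | ∑ i, n i = ∑ i, k i}
  set f : ParticleConfig L → ℝ := S.indicator 1 with hfS
  have hf : Measurable f := Measurable.of_discrete
  have hb : ∀ n, |f n| ≤ 1 := fun n => by
    by_cases h : n ∈ S <;> simp [f, h]
  -- `f` is constant on each sector, and the generator acts within sectors.
  have hG0 : dualGenerator L A B a b f = 0 := by
    funext n
    refine (dualGenerator_congr A B a b (g := fun _ => f n) fun m hm => ?_).trans
      (dualGenerator_const A B a b _ n)
    simp only [f, S, Set.indicator_apply, Set.mem_ofPred_eq, hm, Pi.one_apply]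
  have h := constant_of_has_deriv_right_zero (f := fun s => semigroupAct κ f s k) (a := 0)
    (b := (t : ℝ)) ((hG.continuousOn hκ ⟨1, hb⟩ hf hb k).mono Set.Icc_subset_Ici_self)
    (fun s hs => by
      have := hG.hasDerivWithinAt_forward hκ ⟨1, hb⟩ hf hb k hs.1
      rw [hG0] at this
      simpa [semigroupAct] using this)
    t ⟨t.2, le_rfl⟩
  have hk : f k = 1 := by simp [f, S]
  rw [hκ.semigroupAct_zero hf, hk, semigroupAct, Real.toNNReal_coe, hfS,
    integral_indicator_one (MeasurableSet.of_discrete)] at h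
  refine (prob_compl_eq_zero_iff (MeasurableSet.of_discrete (s := S))).2 ?_
  exact (ENNReal.toReal_eq_one_iff _).1 h

/-- On the configurations of `N` walkers, the backward equation of the dual process is a linear
differential equation in finite dimension. -/
theorem dual_solves (hκ : IsMarkovSemigroup κ)
    (hG : HasGenerator κ (boundedFunctions L) (dualGenerator L A B a b))
    (y : Sector L N → ℝ) :
    ContinuousOn (fun s => fun n : Sector L N => semigroupAct κ (extendSector y) s n.1)
      (Set.Ici 0) ∧
    ∀ t, 0 ≤ t → HasDerivWithinAt
      (fun s => fun n : Sector L N => semigroupAct κ (extendSector y) s n.1)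
      (sectorGenerator L N A B a b fun n => semigroupAct κ (extendSector y) t n.1)
      (Set.Ici t) t := by
  have hm : Measurable (extendSector y) := Measurable.of_discrete
  have hb := abs_extendSector_le y
  refine ⟨continuousOn_pi.2 fun n => hG.continuousOn hκ ⟨_, hb⟩ hm hb n.1, fun t ht => ?_⟩
  refine hasDerivWithinAt_pi.2 fun n => ?_
  rw [sectorGenerator_eq A B a b (f := semigroupAct κ (extendSector y) t) fun _ => rfl]
  exact hG.hasDerivWithinAt_backward hκ hm hb n.1 ht ⟨‖y‖, fun x => hκ.abs_integral_le hb _ x⟩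

end Dual

end KMP
namespace KMP

variable {L N : ℕ} {A B a b βp βm : ℝ}

/-! ### Truncated duality functions under the energy process -/

theorem measurable_dualityFunction (βp βm : ℝ) (n : ParticleConfig L) :
    Measurable (dualityFunction βp βm n) := by
  unfold dualityFunction
  refine Measurable.const_mul (Finset.measurable_prod _ fun x _ => ?_) _
  exact ((((measurable_pi_apply x).comp measurable_subtype_coe).pow_const _).div_const _)

theorem exists_dualityFunction_le (hβp : 0 < βp) (hβm : 0 < βm) (L N : ℕ) :
    ∃ C, 0 ≤ C ∧ ∀ (n : ParticleConfig L), ∑ i, n i = N → ∀ ξ : EnergyConfig L,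
      |dualityFunction βp βm n ξ| ≤ C * oneAddEnergy ξ ^ N := by
  have hpos : ∀ n : ParticleConfig L, 0 ≤ 1 / (βp ^ n .deltaPlus * βm ^ n .deltaMinus) :=
    fun n => by positivity
  refine ⟨∑ n : Sector L N, 1 / (βp ^ n.1 .deltaPlus * βm ^ n.1 .deltaMinus),
    Finset.sum_nonneg fun n _ => hpos n.1, fun n hn ξ => ?_⟩
  rw [abs_of_nonneg (dualityFunction_nonneg hβp hβm n ξ), dualityFunction]
  have hR := one_le_oneAddEnergy ξ
  have hq : ∀ x, 0 ≤ ξ.1 x ^ n (.bulk x) / ((n (.bulk x)).factorial : ℝ) := fun x => by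
    have := (ξ.2 x).le
    positivity
  refine mul_le_mul (Finset.single_le_sum
    (f := fun n : Sector L N => 1 / (βp ^ n.1 .deltaPlus * βm ^ n.1 .deltaMinus))
    (fun n _ => hpos n.1) (Finset.mem_univ ⟨n, hn⟩)) ?_ (Finset.prod_nonneg fun x _ => hq x)
    (Finset.sum_nonneg fun n _ => hpos n.1)
  calc ∏ x : Site L, ξ.1 x ^ n (.bulk x) / ((n (.bulk x)).factorial : ℝ)
      ≤ ∏ x : Site L, oneAddEnergy ξ ^ n (.bulk x) := by
        refine Finset.prod_le_prod (fun x _ => hq x) fun x _ => ?_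
        have h0 := (ξ.2 x).le
        refine (div_le_self (by positivity)
          (by exact_mod_cast Nat.one_le_of_lt (Nat.factorial_pos _))).trans ?_
        exact pow_le_pow_left₀ h0 (energy_le_oneAddEnergy ξ x) _
    _ = oneAddEnergy ξ ^ ∑ x : Site L, n (.bulk x) := Finset.prod_pow_eq_pow_sum _ _ _
    _ ≤ oneAddEnergy ξ ^ N := pow_le_pow_right₀ hR (hn ▸ sum_bulk_le n)

/-- The bond moves conserve the total energy, hence commute with the cutoff. -/
theorem integral_splitEnergy_mul_cutoff (ε : ℝ) (n : ParticleConfig L) (ξ : EnergyConfig L)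
    (e : Bond L) :
    ∫ p : Set.Ioo (0 : ℝ) 1, (dualityFunction βp βm n (splitEnergy ξ e p)
        * cutoff ε N (splitEnergy ξ e p) - dualityFunction βp βm n ξ * cutoff ε N ξ)
        ∂(Measure.comap Subtype.val volume)
      = 1 / ((bondParticles n e : ℝ) + 1) * ∑ q ∈ Finset.range (bondParticles n e + 1),
          (dualityFunction βp βm (splitParticles n e q) ξ * cutoff ε N ξ
            - dualityFunction βp βm n ξ * cutoff ε N ξ) := by
  have hc : ∀ p, cutoff ε N (splitEnergy ξ e p) = cutoff ε N ξ := fun p => by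
    simp only [cutoff, oneAddEnergy_splitEnergy]
  have hi : Integrable (fun p => dualityFunction βp βm n (splitEnergy ξ e p))
      (Measure.comap Subtype.val volume) := by
    simp_rw [dualityFunction_splitEnergy]
    exact (integrable_Ioo_pow_mul_one_sub_pow _ _).const_mul _
  have h4 : (bondParticles n e : ℝ) + 1 ≠ 0 := by positivity
  simp_rw [hc, ← sub_mul]
  rw [integral_mul_const, integral_sub hi (integrable_Ioo_const _), integral_Ioo_const,
    integral_dualityFunction_splitEnergy, ← Finset.sum_mul, Finset.sum_sub_distrib,
    Finset.sum_const, Finset.card_range, nsmul_eq_mul]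
  push_cast
  field_simp

/-- A reservoir move changes the cutoff; the effect is of order `ε`. -/
theorem abs_integral_setEnergy_mul_cutoff_sub_le {β : ℝ} (hβ : 0 < β) {ε : ℝ} (hε : 0 < ε)
    {C : ℝ} (hC0 : 0 ≤ C) {n : ParticleConfig L}
    (hC : ∀ ξ : EnergyConfig L, |dualityFunction βp βm n ξ| ≤ C * oneAddEnergy ξ ^ N)
    (ξ : EnergyConfig L) (x : Site L) :
    |∫ y : Set.Ioi (0 : ℝ), (dualityFunction βp βm n (setEnergy ξ x y)
        * cutoff ε N (setEnergy ξ x y) - dualityFunction βp βm n ξ * cutoff ε N ξ)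
        * (β * Real.exp (-β * y)) ∂(Measure.comap Subtype.val volume)
      - (∫ y : Set.Ioi (0 : ℝ), dualityFunction βp βm n (setEnergy ξ x y)
          * (β * Real.exp (-β * y)) ∂(Measure.comap Subtype.val volume)
        - dualityFunction βp βm n ξ) * cutoff ε N ξ|
      ≤ ε * C * oneAddEnergy ξ ^ (2 * N) * expMoment β (2 * N) := by
  have hR := oneAddEnergy_pos ξ
  have hRy : ∀ y : Set.Ioi (0 : ℝ),
      oneAddEnergy (setEnergy ξ x y) ^ N ≤ oneAddEnergy ξ ^ N * (1 + (y : ℝ)) ^ N := fun y => by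
    rw [← mul_pow]
    exact pow_le_pow_left₀ (oneAddEnergy_pos _).le (oneAddEnergy_setEnergy_le ξ x y) N
  have hF : ∀ y : Set.Ioi (0 : ℝ), |dualityFunction βp βm n (setEnergy ξ x y)|
      ≤ C * oneAddEnergy ξ ^ N * (1 + (y : ℝ)) ^ N := fun y => by
    rw [mul_assoc]
    exact (hC _).trans (mul_le_mul_of_nonneg_left (hRy y) hC0)
  have hmF : Measurable fun y => dualityFunction βp βm n (setEnergy ξ x y) :=
    (measurable_dualityFunction βp βm n).comp (measurable_setEnergy ξ x)
  have hmc : Measurable fun y => cutoff ε N (setEnergy ξ x y) :=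
    (measurable_cutoff ε N).comp (measurable_setEnergy ξ x)
  have hD : ∀ y : Set.Ioi (0 : ℝ), |dualityFunction βp βm n (setEnergy ξ x y)
      * (cutoff ε N (setEnergy ξ x y) - cutoff ε N ξ)|
      ≤ ε * C * oneAddEnergy ξ ^ (2 * N) * (1 + (y : ℝ)) ^ (2 * N) := fun y => by
    have hy : (0 : ℝ) < y := y.2
    have h1 : 1 ≤ (1 + (y : ℝ)) ^ N := one_le_pow₀ (by linarith)
    have h2 : |oneAddEnergy (setEnergy ξ x y) ^ N - oneAddEnergy ξ ^ N|
        ≤ oneAddEnergy ξ ^ N * (1 + (y : ℝ)) ^ N := by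
      have h3 := le_mul_of_one_le_right (pow_nonneg hR.le N) h1
      have h4 := pow_nonneg (oneAddEnergy_pos (setEnergy ξ x y)).le N
      have h5 := pow_nonneg hR.le N
      rw [abs_le]
      constructor <;> linarith [hRy y]
    rw [abs_mul]
    calc _ ≤ (C * oneAddEnergy ξ ^ N * (1 + (y : ℝ)) ^ N)
          * (ε * (oneAddEnergy ξ ^ N * (1 + (y : ℝ)) ^ N)) :=
          mul_le_mul (hF y) ((abs_cutoff_sub_le hε N _ _).trans
            (mul_le_mul_of_nonneg_left h2 hε.le)) (abs_nonneg _) (by positivity)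
      _ = _ := by ring
  have hmD : Measurable fun y => dualityFunction βp βm n (setEnergy ξ x y)
      * (cutoff ε N (setEnergy ξ x y) - cutoff ε N ξ) := hmF.mul (hmc.sub_const _)
  have i1 := integrable_mul_exp_of_le hβ hmD hD
  have i2 := integrable_mul_exp_of_le hβ hmF hF
  have i3 : Integrable (fun y : Set.Ioi (0 : ℝ) => β * Real.exp (-β * y))
      (Measure.comap Subtype.val volume) := by
    simpa using integrable_Ioi_pow_mul_exp hβ 0
  -- Only the difference of the two cutoffs contributes to the error.
  have e : ∀ y : Set.Ioi (0 : ℝ), (dualityFunction βp βm n (setEnergy ξ x y)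
        * cutoff ε N (setEnergy ξ x y) - dualityFunction βp βm n ξ * cutoff ε N ξ)
        * (β * Real.exp (-β * y))
      = dualityFunction βp βm n (setEnergy ξ x y)
          * (cutoff ε N (setEnergy ξ x y) - cutoff ε N ξ) * (β * Real.exp (-β * y))
        + (dualityFunction βp βm n (setEnergy ξ x y) * (β * Real.exp (-β * y))
          - dualityFunction βp βm n ξ * (β * Real.exp (-β * y))) * cutoff ε N ξ := fun y => by
    ring
  simp_rw [e]
  have i23 : Integrable (fun y : Set.Ioi (0 : ℝ) =>
      (dualityFunction βp βm n (setEnergy ξ x y) * (β * Real.exp (-β * y))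
          - dualityFunction βp βm n ξ * (β * Real.exp (-β * y))) * cutoff ε N ξ)
      (Measure.comap Subtype.val volume) := (i2.sub (i3.const_mul _)).mul_const _
  rw [integral_add i1 i23, integral_mul_const, integral_sub i2 (i3.const_mul _),
    integral_const_mul, integral_Ioi_exp hβ, mul_one, add_sub_cancel_right]
  exact integral_mul_exp_le hβ hmD hD

/-- Duality of the generators, up to an error of order `ε` caused by the cutoff. -/
theorem abs_kmpGenerator_sub_dualGenerator_le (hA : 0 < A) (hB : 0 < B) (hβp : 0 < βp)
    (hβm : 0 < βm) {ε : ℝ} (hε : 0 < ε) {C : ℝ} (hC0 : 0 ≤ C) {n : ParticleConfig L}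
    (hC : ∀ ξ : EnergyConfig L, |dualityFunction βp βm n ξ| ≤ C * oneAddEnergy ξ ^ N)
    (ξ : EnergyConfig L) :
    |kmpGenerator L A B a b βp βm (fun ξ => dualityFunction βp βm n ξ * cutoff ε N ξ) ξ
      - dualGenerator L A B a b (fun m => dualityFunction βp βm m ξ * cutoff ε N ξ) n|
      ≤ ε * C * growthRate L A B a b βp βm (2 * N) * oneAddEnergy ξ ^ (2 * N) := by
  have hm := abs_integral_setEnergy_mul_cutoff_sub_le hβm hε hC0 hC ξ (leftEnd L)
  have hp := abs_integral_setEnergy_mul_cutoff_sub_le hβp hε hC0 hC ξ (rightEnd L)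
  rw [integral_dualityFunction_minus hβm] at hm
  rw [integral_dualityFunction_plus hβp] at hp
  have hA' : 0 ≤ A / (L : ℝ) ^ a := by positivity
  have hB' : 0 ≤ B / (L : ℝ) ^ b := by positivity
  have hm' := mul_le_mul_of_nonneg_left hm hA'
  have hp' := mul_le_mul_of_nonneg_left hp hB'
  rw [← abs_of_nonneg hA', ← abs_mul, abs_of_nonneg hA'] at hm'
  rw [← abs_of_nonneg hB', ← abs_mul, abs_of_nonneg hB'] at hp'
  unfold kmpGenerator dualGenerator growthRate
  simp_rw [integral_splitEnergy_mul_cutoff]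
  refine le_trans (le_of_eq ?_) ((abs_add_le _ _).trans ((add_le_add hm' hp').trans (le_of_eq ?_)))
  · congr 1
    ring
  · ring

theorem dualityFunction_mul_cutoff_mem {ε : ℝ} (hε : 0 < ε) {C : ℝ} {n : ParticleConfig L}
    (hC : ∀ ξ : EnergyConfig L, |dualityFunction βp βm n ξ| ≤ C * oneAddEnergy ξ ^ N) :
    (fun ξ => dualityFunction βp βm n ξ * cutoff ε N ξ) ∈ smoothBounded L
      ∧ ∀ ξ : EnergyConfig L, |dualityFunction βp βm n ξ * cutoff ε N ξ| ≤ C * (1 / ε) :=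
  mul_cutoff_mem_smoothBounded hε N
    (g := fun z => 1 / (βp ^ n .deltaPlus * βm ^ n .deltaMinus)
      * ∏ x : Site L, z x ^ n (.bulk x) / ((n (.bulk x)).factorial : ℝ))
    (contDiff_const.mul (contDiff_prod fun x _ => by fun_prop)) hC

section Energy

variable {κ : ℝ≥0 → Kernel (EnergyConfig L) (EnergyConfig L)}

theorem integrable_dualityFunction (hA : 0 < A) (hB : 0 < B) (hβp : 0 < βp) (hβm : 0 < βm)
    (hκ : IsMarkovSemigroup κ)
    (hG : HasGenerator κ (smoothBounded L) (kmpGenerator L A B a b βp βm))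
    (n : ParticleConfig L) (ζ : EnergyConfig L) (t : ℝ≥0) :
    Integrable (dualityFunction βp βm n) (κ t ζ) := by
  obtain ⟨C, -, hC⟩ := exists_dualityFunction_le hβp hβm L (∑ i, n i)
  exact ((integrable_oneAddEnergy_pow hA hB hβp hβm hκ hG (∑ i, n i) ζ t).const_mul C).mono'
    (measurable_dualityFunction βp βm n).aestronglyMeasurable (Eventually.of_forall (hC n rfl))

/-- The expectations of the truncated duality functions solve the differential equation of the
dual process up to an error of order `ε`. -/
theorem truncated_solves (hA : 0 < A) (hB : 0 < B) (hβp : 0 < βp) (hβm : 0 < βm)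
    (hκ : IsMarkovSemigroup κ)
    (hG : HasGenerator κ (smoothBounded L) (kmpGenerator L A B a b βp βm))
    {C : ℝ} (hC0 : 0 ≤ C) (hC : ∀ (n : ParticleConfig L), ∑ i, n i = N →
      ∀ ξ : EnergyConfig L, |dualityFunction βp βm n ξ| ≤ C * oneAddEnergy ξ ^ N)
    (ζ : EnergyConfig L) {ε : ℝ} (hε : 0 < ε) {t T : ℝ} (ht : 0 ≤ t) (htT : t ≤ T) :
    dist (fun n : Sector L N => semigroupAct κ (kmpGenerator L A B a b βp βm
        (fun ξ => dualityFunction βp βm n.1 ξ * cutoff ε N ξ)) t ζ)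
      (sectorGenerator L N A B a b fun n : Sector L N => semigroupAct κ
        (fun ξ => dualityFunction βp βm n.1 ξ * cutoff ε N ξ) t ζ)
      ≤ ε * (C * growthRate L A B a b βp βm (2 * N) * (oneAddEnergy ζ ^ (2 * N)
          * Real.exp (growthRate L A B a b βp βm (2 * N) * T))) := by
  have hγ := growthRate_nonneg (L := L) (a := a) (b := b) hA hB hβp hβm (2 * N)
  have hR := oneAddEnergy_pos ζ
  rw [dist_pi_le_iff (by positivity)]
  intro n
  have hmeas : ∀ m : ParticleConfig L,
      Measurable fun ξ => dualityFunction βp βm m ξ * cutoff ε N ξ := fun m =>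
    (measurable_dualityFunction βp βm m).mul (measurable_cutoff ε N)
  obtain ⟨hD, hb⟩ := dualityFunction_mul_cutoff_mem hε (hC n.1 n.2)
  obtain ⟨C', hC'⟩ := hG.exists_bound hκ hD hb
  have i1 := hκ.integrable (hG.measurable hκ hD (hmeas n.1)) hC' t.toNNReal ζ
  obtain ⟨i2, e2⟩ := dualGenerator_integral (μ := κ t.toNNReal ζ) A B a b
    (h := fun m ξ => dualityFunction βp βm m ξ * cutoff ε N ξ) (n := n.1) fun m hm =>
      hκ.integrable (hmeas m) (dualityFunction_mul_cutoff_mem hε (hC m (hm.trans n.2))).2 _ ζ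
  rw [sectorGenerator_eq A B a b (f := fun m => semigroupAct κ
    (fun ξ => dualityFunction βp βm m ξ * cutoff ε N ξ) t ζ) fun _ => rfl, Real.dist_eq]
  simp only [semigroupAct]
  rw [← e2, ← integral_sub i1 i2]
  have i3 := (integrable_oneAddEnergy_pow hA hB hβp hβm hκ hG (2 * N) ζ t.toNNReal).const_mul
    (ε * C * growthRate L A B a b βp βm (2 * N))
  refine abs_integral_le_integral_abs.trans ((integral_mono (i1.sub i2).abs i3 fun ξ =>
    abs_kmpGenerator_sub_dualGenerator_le hA hB hβp hβm hε hC0 (hC n.1 n.2) ξ).trans ?_)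
  rw [integral_const_mul, mul_assoc ε, mul_assoc ε]
  refine mul_le_mul_of_nonneg_left (mul_le_mul_of_nonneg_left ?_ (by positivity)) hε.le
  refine (integral_oneAddEnergy_pow_le hA hB hβp hβm hκ hG (2 * N) ζ t.toNNReal).trans ?_
  rw [Real.coe_toNNReal t ht]
  gcongr

theorem tendsto_semigroupAct_truncated (hA : 0 < A) (hB : 0 < B) (hβp : 0 < βp) (hβm : 0 < βm)
    (hκ : IsMarkovSemigroup κ)
    (hG : HasGenerator κ (smoothBounded L) (kmpGenerator L A B a b βp βm))
    (n : ParticleConfig L) (ζ : EnergyConfig L) (t : ℝ) :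
    Tendsto (fun ε => semigroupAct κ (fun ξ => dualityFunction βp βm n ξ * cutoff ε N ξ) t ζ)
      (𝓝[>] 0) (𝓝 (semigroupAct κ (dualityFunction βp βm n) t ζ)) := by
  refine tendsto_integral_filter_of_dominated_convergence
    (fun ξ => |dualityFunction βp βm n ξ|)
    (Eventually.of_forall fun ε =>
      ((measurable_dualityFunction βp βm n).mul (measurable_cutoff ε N)).aestronglyMeasurable)
    ?_ (integrable_dualityFunction hA hB hβp hβm hκ hG n ζ _).abs
    (Eventually.of_forall fun ξ => ?_)
  · filter_upwards [self_mem_nhdsWithin] with ε hε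
    refine Eventually.of_forall fun ξ => ?_
    rw [Real.norm_eq_abs, abs_mul, abs_of_nonneg (cutoff_nonneg hε N ξ)]
    exact mul_le_of_le_one_right (abs_nonneg _) (cutoff_le_one hε N ξ)
  · simpa using (tendsto_cutoff N ξ).const_mul (dualityFunction βp βm n ξ)

/-! ### Duality of the semigroups -/

/-- Duality at the level of the semigroups, in the sector of `N` walkers: as the cutoff is
removed, Grönwall's inequality forces the two solutions of the same linear differential equation
to agree. -/
theorem semigroupAct_dualityFunction_eq (hA : 0 < A) (hB : 0 < B) (hβp : 0 < βp) (hβm : 0 < βm)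
    (hκ : IsMarkovSemigroup κ)
    (hG : HasGenerator κ (smoothBounded L) (kmpGenerator L A B a b βp βm))
    {κ' : ℝ≥0 → Kernel (ParticleConfig L) (ParticleConfig L)} (hκ' : IsMarkovSemigroup κ')
    (hG' : HasGenerator κ' (boundedFunctions L) (dualGenerator L A B a b))
    (ζ : EnergyConfig L) (n : Sector L N) {T : ℝ} (hT : 0 ≤ T) :
    semigroupAct κ (dualityFunction βp βm n.1) T ζ
      = semigroupAct κ' (extendSector fun m : Sector L N => dualityFunction βp βm m.1 ζ)
          T n.1 := by
  obtain ⟨C, hC0, hC⟩ := exists_dualityFunction_le hβp hβm L N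
  obtain ⟨Λ, hΛ, hlip⟩ := exists_lipschitzWith_sectorGenerator hA hB L N a b
  set y : Sector L N → ℝ := fun m => dualityFunction βp βm m.1 ζ with hy
  obtain ⟨hcont', hder'⟩ := dual_solves hκ' hG' y
  set M := C * growthRate L A B a b βp βm (2 * N) * (oneAddEnergy ζ ^ (2 * N)
          * Real.exp (growthRate L A B a b βp βm (2 * N) * T))
  set M₀ := C * oneAddEnergy ζ ^ (2 * N)
  have hR := oneAddEnergy_pos ζ
  have key : ∀ ε : ℝ, 0 < ε →
      dist (fun m : Sector L N =>
          semigroupAct κ (fun ξ => dualityFunction βp βm m.1 ξ * cutoff ε N ξ) T ζ)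
        (fun m : Sector L N => semigroupAct κ' (extendSector y) T m.1)
        ≤ gronwallBound (ε * M₀) Λ (ε * M + 0) (T - 0) := by
    intro ε hε
    have hmeas : ∀ m : ParticleConfig L,
        Measurable fun ξ => dualityFunction βp βm m ξ * cutoff ε N ξ := fun m =>
      (measurable_dualityFunction βp βm m).mul (measurable_cutoff ε N)
    have hmem := fun m : Sector L N => dualityFunction_mul_cutoff_mem hε (hC m.1 m.2)
    refine dist_le_of_approx_trajectories_ODE (v := fun _ => sectorGenerator L N A B a b)
      (f := fun s => fun m : Sector L N =>
        semigroupAct κ (fun ξ => dualityFunction βp βm m.1 ξ * cutoff ε N ξ) s ζ)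
      (f' := fun s => fun m : Sector L N => semigroupAct κ (kmpGenerator L A B a b βp βm
        (fun ξ => dualityFunction βp βm m.1 ξ * cutoff ε N ξ)) s ζ)
      (g := fun s => fun m : Sector L N => semigroupAct κ' (extendSector y) s m.1)
      (fun _ => hlip) ?_ ?_ ?_ (hcont'.mono Set.Icc_subset_Ici_self)
      (fun t ht => hder' t ht.1) (fun t _ => (dist_self _).le) ?_ T ⟨hT, le_rfl⟩
    · exact continuousOn_pi.2 fun m => (hG.continuousOn hκ (hmem m).1 (hmeas m.1) (hmem m).2
        ζ).mono Set.Icc_subset_Ici_self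
    · exact fun t ht => hasDerivWithinAt_pi.2 fun m =>
        hG.hasDerivWithinAt_forward hκ (hmem m).1 (hmeas m.1) (hmem m).2 ζ ht.1
    · exact fun t ht => truncated_solves hA hB hβp hβm hκ hG hC0 hC ζ hε ht.1 ht.2.le
    · rw [dist_pi_le_iff (by positivity)]
      intro m
      rw [hκ.semigroupAct_zero (hmeas m.1), hκ'.semigroupAct_zero Measurable.of_discrete,
        extendSector_of_sum_eq y m.2, Real.dist_eq, abs_sub_comm]
      have e : y m - dualityFunction βp βm m.1 ζ * cutoff ε N ζ
          = dualityFunction βp βm m.1 ζ * (1 - cutoff ε N ζ) := by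
        simp only [hy]
        ring
      change |y m - _| ≤ _
      rw [e, abs_mul]
      calc _ ≤ (C * oneAddEnergy ζ ^ N) * (ε * oneAddEnergy ζ ^ N) :=
            mul_le_mul (hC m.1 m.2 ζ) (abs_one_sub_cutoff_le hε N ζ) (abs_nonneg _)
              (by positivity)
        _ = ε * M₀ := by simp only [M₀]; ring
  have hlim : Tendsto (fun ε : ℝ => gronwallBound (ε * M₀) Λ (ε * M + 0) (T - 0))
      (𝓝[>] 0) (𝓝 0) := by
    have hne : (Λ : ℝ) ≠ 0 := (NNReal.coe_pos.2 hΛ).ne'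
    simp only [gronwallBound_of_K_ne_0 hne]
    have hc : Continuous fun ε : ℝ => ε * M₀ * Real.exp (Λ * (T - 0))
        + (ε * M + 0) / Λ * (Real.exp (Λ * (T - 0)) - 1) := by fun_prop
    have := (hc.tendsto 0).mono_left (nhdsWithin_le_nhds (s := Set.Ioi 0))
    simpa using this
  have hzero : Tendsto (fun ε =>
      semigroupAct κ (fun ξ => dualityFunction βp βm n.1 ξ * cutoff ε N ξ) T ζ)
      (𝓝[>] 0) (𝓝 (semigroupAct κ' (extendSector y) T n.1)) := by
    rw [tendsto_iff_dist_tendsto_zero]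
    refine squeeze_zero' (Eventually.of_forall fun _ => dist_nonneg) ?_ hlim
    filter_upwards [self_mem_nhdsWithin] with ε hε
    exact (dist_le_pi_dist _ _ n).trans (key ε hε)
  exact tendsto_nhds_unique
    (tendsto_semigroupAct_truncated hA hB hβp hβm hκ hG n.1 ζ T) hzero

end Energy

end KMP

theorem mainTheorem3 (L : ℕ) (hL : 0 < L) (A B a b βp βm : ℝ)
    (hA : 0 < A) (hB : 0 < B) (hβp : 0 < βp) (hβm : 0 < βm)
    (ζ : KMP.EnergyConfig L) (k : KMP.ParticleConfig L)
    {Ω : Type*} [MeasurableSpace Ω] (P : Measure Ω) [IsProbabilityMeasure P]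
    (ξ : ℝ≥0 → Ω → KMP.EnergyConfig L)
    (hξ : KMP.IsMarkovProcessWithGenerator (KMP.smoothBounded L)
      (KMP.kmpGenerator L A B a b βp βm) ζ P ξ)
    {Ω' : Type*} [MeasurableSpace Ω'] (Q : Measure Ω') [IsProbabilityMeasure Q]
    (η : ℝ≥0 → Ω' → KMP.ParticleConfig L)
    (hη : KMP.IsMarkovProcessWithGenerator (KMP.boundedFunctions L)
      (KMP.dualGenerator L A B a b) k Q η)
    (t : ℝ≥0) :
    Integrable (fun ω => KMP.dualityFunction βp βm k (ξ t ω)) P ∧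
    Integrable (fun ω => KMP.dualityFunction βp βm (η t ω) ζ) Q ∧
    ∫ ω, KMP.dualityFunction βp βm k (ξ t ω) ∂P
      = ∫ ω, KMP.dualityFunction βp βm (η t ω) ζ ∂Q := by
  obtain ⟨κ, hκ, hG, hX⟩ := hξ
  obtain ⟨κ', hκ', hG', hY⟩ := hη
  have hlawX := hX.map_eq hκ t
  have hlawY := hY.map_eq hκ' t
  have hmX := hX.measurable t
  have hmY := hY.measurable t
  have hmF := KMP.measurable_dualityFunction βp βm k
  have hmH : Measurable fun n : KMP.ParticleConfig L => KMP.dualityFunction βp βm n ζ :=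
    Measurable.of_discrete
  let y : KMP.Sector L (∑ i, k i) → ℝ := fun m => KMP.dualityFunction βp βm m.1 ζ
  have hae : (KMP.extendSector y) =ᵐ[κ' t k] fun n => KMP.dualityFunction βp βm n ζ := by
    filter_upwards [KMP.dual_ae_sum_eq hκ' hG' k t] with n hn
    exact KMP.extendSector_of_sum_eq y hn
  have iX : Integrable (KMP.dualityFunction βp βm k) (P.map (ξ t)) :=
    hlawX ▸ KMP.integrable_dualityFunction hA hB hβp hβm hκ hG k ζ t
  have iY : Integrable (fun n => KMP.dualityFunction βp βm n ζ) (Q.map (η t)) := by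
    rw [hlawY]
    exact (hκ'.integrable Measurable.of_discrete (KMP.abs_extendSector_le y) t k).congr hae
  refine ⟨iX.comp_measurable hmX, iY.comp_measurable hmY, ?_⟩
  have h := KMP.semigroupAct_dualityFunction_eq hA hB hβp hβm hκ hG hκ' hG' ζ
    (⟨k, rfl⟩ : KMP.Sector L (∑ i, k i)) t.coe_nonneg
  rw [← integral_map hmX.aemeasurable hmF.aestronglyMeasurable,
    ← integral_map hmY.aemeasurable hmH.aestronglyMeasurable, hlawX, hlawY,
    ← integral_congr_ae hae]
  simpa only [KMP.semigroupAct, Real.toNNReal_coe] using h
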